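/- Let $N\ge 2$, $1<p<2$, $1<q\le p$, and write $x=(x',y)\in\mathbb R^{N-1}\times\mathbb R$ and $\mathbb R^N_+=\{y>0\}$. Let $a,b,f:\mathbb R^N_+\times\mathbb R\to\mathbb R$ be continuous functions such that $a(x,s)\ge\gamma>0$ for all $(x,s)\in\mathbb R^N_+\times\mathbb R$ and such that, for every $M>0$, there are positive constants $L_a(M),L_b(M),L_f(M),K(M)$ with $$|a(x,s)-a(x,t)|\le L_a(M)|s-t|,\quad |b(x,s)-b(x,t)|\le L_b(M)|s-t|,\quad |f(x,s)-f(x,t)|\le L_f(M)|s-t|,$$ $$|a(x,s)|\le K(M),\qquad |b(x,s)|\le K(M)$$ for all $x\in\mathbb R^N_+$ and $s,t\in[-M,M]$. Fix $\lambda_0>0$ and $M_0>0$. Then there are $\tau_0>0$ and $\varepsilon_0>0$, depending only on $N,p,q,\lambda_0,M_0,\gamma$ and on the structural constants $L_a(M_0),L_b(M_0),L_f(M_0),K(M_0)$, such that the following holds whenever $0<\lambda\le\lambda_0$, $y_0\ge\lambda/2$, $0<\tau<\tau_0$, $0<\varepsilon<\varepsilon_0$ and $0<\alpha<1$. Put $$\Sigma=\mathbb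 R^{N-1}\times\left(y_0-\tfrac\lambda2,\,y_0+\tfrac\lambda2\right).$$ Let $u,v\in C^{1,\alpha}_{loc}(\overline\Sigma)$ satisfy $\|u\|_{L^\infty(\Sigma)}+\|\nabla u\|_{L^\infty(\Sigma)}\le M_0$ and $\|v\|_{L^\infty(\Sigma)}+\|\nabla v\|_{L^\infty(\Sigma)}\le M_0$, and, in the weak sense (tested with nonnegative functions in $C_c^\infty(\Sigma)$), $$-\mathrm{div}\big(a(x,u)|\nabla u|^{p-2}\nabla u\big)+b(x,u)|\nabla u|^q\le f(x,u)\quad\text{in }\Sigma,$$ $$-\mathrm{div}\big(a(x,v)|\nabla v|^{p-2}\nabla v\big)+b(x,v)|\nabla v|^q\ge f(x,v)\quad\text{in }\Sigma.$$ Let $S\subseteq\Sigma$ be an open set such that, for every $x'\in\mathbb R^{N-1}$, the section $\{y\in\mathbb R:(x',y)\in S\}$ equals $A_{x'}\cup B_{x'}$ with measurable sets $A_{x'},B_{x'}$ satisfying $$|A_{x'}\cap B_{x'}|=0,\qquad |A_{x'}|\le\tau,\qquad B_{x'}\subseteq\{y:\ |\nabla u(x',y)|<\varepsilon,\ |\nabla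 v(x',y)|<\varepsilon\},$$ and suppose that $u\le v$ on $\partial S$. Then $u\le v$ in $S$. Moreover, suppose that $a,b,f$ are globally Lipschitz continuous in the second variable, uniformly in $x\in\mathbb R^N_+$, with constants $L_a,L_b,L_f$ (in particular, this holds if they are globally Lipschitz on $\mathbb R^N_+\times\mathbb R$), and that $|a|,|b|\le K$ on $\mathbb R^N_+\times\mathbb R$. Then the same conclusion holds without any assumption on the boundedness of $u$ and $v$: it suffices that $\|\nabla u\|_{L^\infty(\Sigma)}\le M_0$ and $\|\nabla v\|_{L^\infty(\Sigma)}\le M_0$, and $\tau_0,\varepsilon_0$ then depend only on $N,p,q,\lambda_0,M_0,\gamma,L_a,L_b,L_f,K$. -/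

import Mathlib

open MeasureTheory Set
open scoped NNReal ENNReal ContDiff Gradient

noncomputable section

namespace StripComparison

/-- The Euclidean space `ℝ^N` with `N = n + 1`. A point is written `x = (x', y)` with
`x' ∈ ℝ^(N-1)` and `y` the last coordinate. -/
abbrev Space (n : ℕ) : Type := EuclideanSpace ℝ (Fin (n + 1))

/-- The point `(x', y)` of `ℝ^N`. -/
def point {n : ℕ} (x' : EuclideanSpace ℝ (Fin n)) (y : ℝ) : Space n :=
  WithLp.toLp 2 (Fin.snoc (α := fun _ => ℝ) (fun i => x' i) y)

/-- The open half space `ℝ^N_+ = {(x', y) : y > 0}`. -/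
def halfSpace (n : ℕ) : Set (Space n) := {x | 0 < x (Fin.last n)}

/-- The strip `ℝ^(N-1) × (y₀ - lam/2, y₀ + lam/2)`. -/
def strip (n : ℕ) (lam y₀ : ℝ) : Set (Space n) :=
  {x | x (Fin.last n) ∈ Ioo (y₀ - lam / 2) (y₀ + lam / 2)}

/-- The function `u` belongs to `C^{1,α}_loc` of the closure of the open set `Ω`: it is continuous
up to the boundary, differentiable in `Ω`, and its gradient is `α`-Hölder continuous on
`K ∩ Ω` for every compact subset `K` of the closure (so that the gradient extends to the closure
as a locally `α`-Hölder map). -/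
def C1HolderLocClosure {n : ℕ} (α : ℝ≥0) (Ω : Set (Space n)) (u : Space n → ℝ) : Prop :=
  ContinuousOn u (closure Ω) ∧ DifferentiableOn ℝ u Ω ∧
    ∀ K : Set (Space n), IsCompact K → K ⊆ closure Ω →
      ∃ C : ℝ≥0, HolderOnWith C α (fun x => ∇ u x) (K ∩ Ω)

/-- The integrand of the left-hand side of the weak formulation of
`-div (a(x,u) |∇u|^(p-2) ∇u) + b(x,u) |∇u|^q`, tested with `φ`. The flux `|∇u|^(p-2) ∇u` is `0`
where `∇u = 0`. -/
def weakLHS {n : ℕ} (p q : ℝ) (a b : Space n → ℝ → ℝ) (u φ : Space n → ℝ) (x : Space n) : ℝ :=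
  a x (u x) * inner ℝ ((‖∇ u x‖ ^ (p - 2)) • ∇ u x) (∇ φ x) + b x (u x) * ‖∇ u x‖ ^ q * φ x

/-- Nonnegative test functions `φ ∈ C_c^∞(Ω)`. -/
def IsNonnegTest {n : ℕ} (Ω : Set (Space n)) (φ : Space n → ℝ) : Prop :=
  ContDiff ℝ ∞ φ ∧ HasCompactSupport φ ∧ tsupport φ ⊆ Ω ∧ ∀ x, 0 ≤ φ x

/-- Weak subsolutions: `-div (a(x,u) |∇u|^(p-2) ∇u) + b(x,u) |∇u|^q ≤ f(x,u)` in `Ω`. -/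
def IsWeakSubsolution {n : ℕ} (p q : ℝ) (a b f : Space n → ℝ → ℝ) (Ω : Set (Space n))
    (u : Space n → ℝ) : Prop :=
  ∀ φ : Space n → ℝ, IsNonnegTest Ω φ →
    ∫ x in Ω, weakLHS p q a b u φ x ≤ ∫ x in Ω, f x (u x) * φ x

/-- Weak supersolutions: `-div (a(x,v) |∇v|^(p-2) ∇v) + b(x,v) |∇v|^q ≥ f(x,v)` in `Ω`. -/
def IsWeakSupersolution {n : ℕ} (p q : ℝ) (a b f : Space n → ℝ → ℝ) (Ω : Set (Space n))
    (v : Space n → ℝ) : Prop :=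
  ∀ φ : Space n → ℝ, IsNonnegTest Ω φ →
    ∫ x in Ω, f x (v x) * φ x ≤ ∫ x in Ω, weakLHS p q a b v φ x

/-- The coefficient is continuous on `ℝ^N_+ × ℝ`. -/
def ContinuousCoeff {n : ℕ} (g : Space n → ℝ → ℝ) : Prop :=
  ContinuousOn (fun z : Space n × ℝ => g z.1 z.2) (halfSpace n ×ˢ univ)

/-- For values of the second variable in `I`, uniformly in `x ∈ ℝ^N_+`: the functions `a, b, f` are
Lipschitz in the second variable with constants `La, Lb, Lf`, and `|a|, |b| ≤ K`. -/
structure CoeffBounds {n : ℕ} (I : Set ℝ) (a b f : Space n → ℝ → ℝ) (La Lb Lf K : ℝ) : Prop where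
  lip_a : ∀ x ∈ halfSpace n, ∀ s ∈ I, ∀ t ∈ I, |a x s - a x t| ≤ La * |s - t|
  lip_b : ∀ x ∈ halfSpace n, ∀ s ∈ I, ∀ t ∈ I, |b x s - b x t| ≤ Lb * |s - t|
  lip_f : ∀ x ∈ halfSpace n, ∀ s ∈ I, ∀ t ∈ I, |f x s - f x t| ≤ Lf * |s - t|
  bound_a : ∀ x ∈ halfSpace n, ∀ s ∈ I, |a x s| ≤ K
  bound_b : ∀ x ∈ halfSpace n, ∀ s ∈ I, |b x s| ≤ K

/-- `a, b, f` are locally Lipschitz and `a, b` locally bounded in the second variable,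
uniformly with respect to `x ∈ ℝ^N_+`. -/
def LocallyLipschitzCoeffs {n : ℕ} (a b f : Space n → ℝ → ℝ) : Prop :=
  ∀ M : ℝ, 0 < M → ∃ La Lb Lf K : ℝ, 0 < La ∧ 0 < Lb ∧ 0 < Lf ∧ 0 < K ∧
    CoeffBounds (Icc (-M) M) a b f La Lb Lf K

/-- `a, b, f` are continuous on `ℝ^N_+ × ℝ`, and `a ≥ γ` there. -/
structure AdmissibleCoeffs {n : ℕ} (γ : ℝ) (a b f : Space n → ℝ → ℝ) : Prop where
  cont_a : ContinuousCoeff a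
  cont_b : ContinuousCoeff b
  cont_f : ContinuousCoeff f
  ellipticity : ∀ x ∈ halfSpace n, ∀ s : ℝ, γ ≤ a x s

/-- `L^∞` norm over `Ω`, with values in `[0, ∞]`. -/
def supNorm {n : ℕ} {F : Type*} [NormedAddCommGroup F] (Ω : Set (Space n)) (g : Space n → F) :
    ℝ≥0∞ :=
  eLpNorm g ∞ (volume.restrict Ω)

/-- Every vertical section `{y : (x', y) ∈ S}` is a union `A ∪ B` of Lebesgue measurable sets with
`|A ∩ B| = 0`, `|A| ≤ τ`, and `|∇u(x', ·)| < ε`, `|∇v(x', ·)| < ε` on `B`. -/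
def SectionsSplit {n : ℕ} (τ ε : ℝ) (u v : Space n → ℝ) (S : Set (Space n)) : Prop :=
  ∀ x' : EuclideanSpace ℝ (Fin n), ∃ A B : Set ℝ,
    NullMeasurableSet A volume ∧ NullMeasurableSet B volume ∧
    {y : ℝ | point x' y ∈ S} = A ∪ B ∧ volume (A ∩ B) = 0 ∧
    volume A ≤ ENNReal.ofReal τ ∧
    B ⊆ {y : ℝ | ‖∇ u (point x' y)‖ < ε ∧ ‖∇ v (point x' y)‖ < ε}

/-- The comparison problem: `u, v ∈ C^{1,α}_loc` of the closed strip are a weak subsolution and a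
weak supersolution in the strip, `S` is an open subset of the strip whose sections split with
parameters `τ, ε`, and `u ≤ v` on `∂S`. -/
structure IsComparisonProblem {n : ℕ} (p q : ℝ) (a b f : Space n → ℝ → ℝ) (α : ℝ≥0)
    (lam y₀ τ ε : ℝ) (u v : Space n → ℝ) (S : Set (Space n)) : Prop where
  reg_u : C1HolderLocClosure α (strip n lam y₀) u
  reg_v : C1HolderLocClosure α (strip n lam y₀) v
  sub_u : IsWeakSubsolution p q a b f (strip n lam y₀) u
  super_v : IsWeakSupersolution p q a b f (strip n lam y₀) v
  isOpen : IsOpen S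
  subset : S ⊆ strip n lam y₀
  split : SectionsSplit τ ε u v S
  boundary : ∀ x ∈ frontier S, u x ≤ v x

end StripComparison

end

/-! Write `N = n + 1` and suppose `u > v` somewhere in `S`. Put `w = 1_S (u - v - δ)^+` and `η = (1
- d²|x'|²)^+`, a cutoff in the horizontal variables only, with `δ = d²`. Since `u ≤ v` on `∂S`, the
shift `δ > 0` gives `wη` compact support inside `S`, so products of powers of `w` and `η` are `C¹`
test functions, admissible after mollification.

Two estimates compare `J = ∫ (wη)^(2n+2)` with the weighted energy `E = ∫ (|∇u|+|∇v|)^(p-2) |∇u-∇v|²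
w^(2n) η^(2n+2)`. Testing the difference of the two inequalities with `w^(2n+1) η^(2n+2)`, strong
monotonicity of the flux (`flux_coercive`) and Young's inequality give `c E ≤ C (J + e)`, where `e`
collects the errors due to cutoff and shift (`exists_energy_estimate`). Conversely, `η` is constant
in `y`, so Cauchy–Schwarz on vertical sections, applied to `∂_y (wη)^(n+1)`, gives `J ≤ θ E`
(`lintegral_truncDiff_pow_le`). Here `θ` contains the integral of the inverse weight
`(|∇u|+|∇v|)^(2-p)` over a section. As `p < 2`, this weight is bounded on the short set `A` and
small on `B`, so `θ` is small with `τ` and `ε`. Once `θ C ≤ c/2`, the two estimates yield `J ≤ e`.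

The exponents are chosen to make `e` vanish: every error term has degree at least `2n+2` in `(wη,
d)` for `d ≤ 1`, so Young's inequality leaves `d^(2n+2)` on a set of volume `O(d^(-n))`, and `e =
O(d^(n+2))`. No bound on `w` enters, which is why gradient bounds suffice for globally Lipschitz
coefficients. As `d → 0` the integral `J` stays above a positive constant
(`exists_lower_bound_integral`), a contradiction. -/

noncomputable section

namespace StripComparison

/-! ### Elementary inequalities for the `p`-Laplacian flux -/

section Flux

variable {E : Type*} [NormedAddCommGroup E] [InnerProductSpace ℝ E]

/-- Bernoulli's inequality at `t / r - 1`, i.e. the tangent-line bound for a concave power at `r`.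
The companion below is the convex case. -/
lemma rpow_mul_sub_le_rpow_sub_rpow {r t e : ℝ} (ht : 0 ≤ t) (htr : t ≤ r) (he0 : 0 ≤ e)
    (he1 : e ≤ 1) : e * r ^ (e - 1) * (r - t) ≤ r ^ e - t ^ e := by
  rcases eq_or_lt_of_le (ht.trans htr) with hr | hr
  · have : t = 0 := le_antisymm (hr ▸ htr) ht
    simp [← hr, this]
  have h := rpow_one_add_le_one_add_mul_self (s := t / r - 1)
    (by have := div_nonneg ht hr.le; linarith) he0 he1
  have h1 : (t / r) ^ e = t ^ e / r ^ e := Real.div_rpow ht hr.le e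
  have hre : 0 < r ^ e := Real.rpow_pos_of_pos hr e
  rw [add_sub_cancel, h1, div_le_iff₀ hre] at h
  rw [Real.rpow_sub_one hr.ne']
  have : (1 + e * (t / r - 1)) * r ^ e = r ^ e - e * (r ^ e / r) * (r - t) := by
    field_simp; ring
  linarith

lemma rpow_sub_rpow_le_rpow_mul_sub {r t e : ℝ} (ht : 0 ≤ t) (htr : t ≤ r) (he : 1 ≤ e) :
    r ^ e - t ^ e ≤ e * r ^ (e - 1) * (r - t) := by
  rcases eq_or_lt_of_le (ht.trans htr) with hr | hr
  · have : t = 0 := le_antisymm (hr ▸ htr) ht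
    simp [← hr, this]
  have h := one_add_mul_self_le_rpow_one_add (s := t / r - 1)
    (by have := div_nonneg ht hr.le; linarith) he
  have h1 : (t / r) ^ e = t ^ e / r ^ e := Real.div_rpow ht hr.le e
  have hre : 0 < r ^ e := Real.rpow_pos_of_pos hr e
  rw [add_sub_cancel, h1, le_div_iff₀ hre] at h
  rw [Real.rpow_sub_one hr.ne']
  have : (1 + e * (t / r - 1)) * r ^ e = r ^ e - e * (r ^ e / r) * (r - t) := by
    field_simp; ring
  linarith

lemma rpow_sub_two_mul_sq {r p : ℝ} (hr : 0 ≤ r) (hp : 1 < p) :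
    r ^ (p - 2) * r ^ 2 = r ^ p := by
  rcases eq_or_lt_of_le hr with h | h
  · rw [← h, Real.zero_rpow (by linarith : p ≠ 0)]; simp
  · rw [← Real.rpow_natCast r 2, ← Real.rpow_add h]; congr 1; push_cast; ring

lemma norm_flux {p : ℝ} (hp : 1 < p) (U : E) : ‖(‖U‖ ^ (p - 2)) • U‖ = ‖U‖ ^ (p - 1) := by
  rw [norm_smul, Real.norm_of_nonneg (by positivity)]
  rcases eq_or_lt_of_le (norm_nonneg U) with h | h
  · rw [← h, Real.zero_rpow (by linarith : p - 1 ≠ 0)]; simp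
  · rw [← Real.rpow_add_one h.ne']; congr 1; ring

lemma continuous_flux {p : ℝ} (hp : 1 < p) :
    Continuous fun U : E => (‖U‖ ^ (p - 2)) • U := by
  rw [continuous_iff_continuousAt]
  intro U
  by_cases hU : U = 0
  · subst hU
    have : Filter.Tendsto (fun U : E => ‖U‖ ^ (p - 1)) (nhds 0) (nhds 0) := by
      have := (continuous_norm (E := E)).continuousAt (x := 0) |>.rpow_const
        (p := p - 1) (Or.inr (by linarith))
      simpa [ContinuousAt, Real.zero_rpow (by linarith : p - 1 ≠ 0)] using this
    simp only [ContinuousAt, smul_zero]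
    exact squeeze_zero_norm (fun U => (norm_flux hp U).le) this
  · exact (continuous_norm.continuousAt.rpow_const (Or.inl (norm_ne_zero_iff.2 hU))).smul
      continuousAt_id

/-- The `p`-Laplacian flux is strongly monotone for `1 < p < 2`. -/
lemma flux_coercive {p : ℝ} (hp1 : 1 < p) (hp2 : p < 2) (U V : E) :
    (p - 1) * ((‖U‖ + ‖V‖) ^ (p - 2) * ‖U - V‖ ^ 2) ≤
      inner ℝ ((‖U‖ ^ (p - 2)) • U - (‖V‖ ^ (p - 2)) • V) (U - V) := by
  wlog hVU : ‖V‖ ≤ ‖U‖ generalizing U V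
  · have := this V U (le_of_not_ge hVU)
    rw [norm_sub_rev V U, add_comm ‖V‖] at this
    refine this.trans_eq ?_
    rw [← inner_neg_neg]; simp
  have hV0 := norm_nonneg V
  have hU0 := norm_nonneg U
  -- The case `V = 0` is separate because monotonicity of the negative power `p - 2` needs a
  -- positive base.
  rcases eq_or_lt_of_le hV0 with hV | hV
  · have hV' : V = 0 := norm_eq_zero.1 hV.symm
    subst hV'
    simp only [norm_zero, add_zero, sub_zero, smul_zero, inner_smul_left, real_inner_self_eq_norm_sq]
    have : 0 ≤ ‖U‖ ^ (p - 2) * ‖U‖ ^ 2 := by positivity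
    simp only [conj_trivial]
    nlinarith
  have hU : 0 < ‖U‖ := hV.trans_le hVU
  set r := ‖U‖
  set t := ‖V‖
  set x : ℝ := inner ℝ U V with hx
  have hx1 : x ≤ r * t := real_inner_le_norm U V
  have hx2 : -(r * t) ≤ x := (abs_le.1 (abs_real_inner_le_norm U V)).1
  have e1 : inner ℝ ((r ^ (p - 2)) • U - (t ^ (p - 2)) • V) (U - V)
      = r ^ (p - 2) * r ^ 2 + t ^ (p - 2) * t ^ 2 - (r ^ (p - 2) + t ^ (p - 2)) * x := by
    simp only [inner_sub_left, inner_sub_right, inner_smul_left, real_inner_self_eq_norm_sq,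
      conj_trivial, real_inner_comm U V, hx, r, t]
    rw [real_inner_comm V U]; ring
  have e2 : ‖U - V‖ ^ 2 = r ^ 2 + t ^ 2 - 2 * x := by
    rw [norm_sub_sq_real]; ring
  rw [e1, e2]
  have hs : (r + t) ^ (p - 2) ≤ r ^ (p - 2) :=
    Real.rpow_le_rpow_of_nonpos hU (by linarith) (by linarith)
  have hs0 : 0 < (r + t) ^ (p - 2) := by positivity
  have hrt : r ^ (p - 2) ≤ t ^ (p - 2) := Real.rpow_le_rpow_of_nonpos hV hVU (by linarith)
  have hr0 : 0 < r ^ (p - 2) := by positivity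
  have ht0 : 0 < t ^ (p - 2) := by positivity
  -- the difference is affine and decreasing in the inner product
  have h1 : (p - 1) * r ^ (p - 2) * (r - t) ≤ r ^ (p - 2) * r - t ^ (p - 2) * t := by
    have := rpow_mul_sub_le_rpow_sub_rpow (e := p - 1) hV0 hVU (by linarith) (by linarith)
    rw [show p - 1 - 1 = p - 2 by ring] at this
    rw [← Real.rpow_add_one hU.ne', ← Real.rpow_add_one hV.ne', show p - 2 + 1 = p - 1 by ring]
    exact this
  have h2 : (p - 1) * (r + t) ^ (p - 2) * (r - t) ^ 2
      ≤ (r ^ (p - 2) * r - t ^ (p - 2) * t) * (r - t) := by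
    have hrt' : 0 ≤ r - t := sub_nonneg.2 hVU
    calc (p - 1) * (r + t) ^ (p - 2) * (r - t) ^ 2
        ≤ (p - 1) * r ^ (p - 2) * (r - t) ^ 2 := by gcongr
      _ = ((p - 1) * r ^ (p - 2) * (r - t)) * (r - t) := by ring
      _ ≤ _ := by gcongr
  -- Since `|U - V|² = (r - t)² + 2(rt - x)`, and the right-hand side splits as `(r^(p-1) -
  -- t^(p-1))(r - t) + (r^(p-2) + t^(p-2))(rt - x)`, the claim is the sum of `h2` (parallel vectors)
  -- and `h3`.
  have h3 : (p - 1) * (2 * (r + t) ^ (p - 2)) * (r * t - x)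
      ≤ (r ^ (p - 2) + t ^ (p - 2)) * (r * t - x) := by
    refine mul_le_mul_of_nonneg_right ?_ (by linarith)
    nlinarith
  nlinarith

lemma rpow_sub_two_mul_norm_sub_sq_le {E : Type*} [NormedAddCommGroup E] {p : ℝ} (hp1 : 1 < p) (U V : E) :
    (‖U‖ + ‖V‖) ^ (p - 2) * ‖U - V‖ ^ 2 ≤ (‖U‖ + ‖V‖) ^ p := by
  rw [← rpow_sub_two_mul_sq (by positivity : 0 ≤ ‖U‖ + ‖V‖) hp1]
  gcongr
  exact norm_sub_le U V

lemma abs_norm_rpow_sub_norm_rpow_le {E : Type*} [NormedAddCommGroup E] {q : ℝ} (hq : 1 ≤ q) (U V : E) :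
    |‖U‖ ^ q - ‖V‖ ^ q| ≤ q * (‖U‖ + ‖V‖) ^ (q - 1) * ‖U - V‖ := by
  wlog hVU : ‖V‖ ≤ ‖U‖ generalizing U V
  · rw [abs_sub_comm, norm_sub_rev, add_comm]
    exact this V U (le_of_not_ge hVU)
  have h := rpow_sub_rpow_le_rpow_mul_sub (norm_nonneg V) hVU hq
  rw [abs_of_nonneg (sub_nonneg.2 (Real.rpow_le_rpow (norm_nonneg V) hVU (by linarith)))]
  refine h.trans ?_
  have h1 : ‖U‖ - ‖V‖ ≤ ‖U - V‖ := norm_sub_norm_le U V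
  have h2 : ‖U‖ ^ (q - 1) ≤ (‖U‖ + ‖V‖) ^ (q - 1) :=
    Real.rpow_le_rpow (norm_nonneg U) (by linarith [norm_nonneg V]) (by linarith)
  have : 0 ≤ ‖U‖ - ‖V‖ := by linarith
  gcongr

/-- `s^(e-1) |D|` is controlled by the square root of the weighted energy density
`s^(p-2) |D|^2`. -/
lemma sq_rpow_mul_le {p e s M D : ℝ} (hs0 : 0 ≤ s) (hs : s ≤ M) (he : p < 2 * e)
    (hD : D ≤ s) (hD0 : 0 ≤ D) :
    (s ^ (e - 1) * D) ^ 2 ≤ M ^ (2 * e - p) * (s ^ (p - 2) * D ^ 2) := by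
  -- At `s = 0` the powers cannot be merged, but then `D ≤ s` forces `D = 0`.
  rcases eq_or_lt_of_le hs0 with h | h
  · have : D = 0 := le_antisymm (hD.trans h.ge) hD0
    simp [this]
  have : (s ^ (e - 1) * D) ^ 2 = s ^ (2 * e - p) * (s ^ (p - 2) * D ^ 2) := by
    rw [mul_pow, ← mul_assoc, ← Real.rpow_add h, ← Real.rpow_mul_natCast hs0]
    congr 2; push_cast; ring
  rw [this]
  gcongr

lemma weighted_young {c k w Y P C : ℝ} (hc : 0 < c) (hP : 0 ≤ P) (hC : 0 ≤ C)
    (hY : Y ^ 2 ≤ C * P) : k * w * Y ≤ c / 2 * P + k ^ 2 * C / (2 * c) * w ^ 2 := by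
  refine (abs_le_of_sq_le_sq' ?_ (by positivity)).2
  -- The square of a sum is the square of the difference plus four times the product, and the
  -- coefficients make the latter `k² w² C P`.
  have e : (c / 2 * P + k ^ 2 * C / (2 * c) * w ^ 2) ^ 2
      = (c / 2 * P - k ^ 2 * C / (2 * c) * w ^ 2) ^ 2 + k ^ 2 * w ^ 2 * (C * P) := by
    field_simp; ring
  rw [e]
  have : (k * w * Y) ^ 2 ≤ k ^ 2 * w ^ 2 * (C * P) := by
    rw [show (k * w * Y) ^ 2 = k ^ 2 * w ^ 2 * Y ^ 2 by ring]; gcongr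
  nlinarith [sq_nonneg (c / 2 * P - k ^ 2 * C / (2 * c) * w ^ 2)]

/-- A crude Young inequality that keeps the total degree `i + j`; it turns every mixed error into
`(wη)^(2n+2) + d^(2n+2)`. -/
lemma pow_mul_pow_le_add {t d : ℝ} (ht : 0 ≤ t) (hd : 0 ≤ d) (i j : ℕ) :
    t ^ i * d ^ j ≤ t ^ (i + j) + d ^ (i + j) := by
  rcases le_total t d with h | h
  · have : t ^ i * d ^ j ≤ d ^ i * d ^ j := by gcongr
    rw [← pow_add] at this
    have : 0 ≤ t ^ (i + j) := by positivity
    linarith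
  · have : t ^ i * d ^ j ≤ t ^ i * t ^ j := by gcongr
    rw [← pow_add] at this
    have : 0 ≤ d ^ (i + j) := by positivity
    linarith

end Flux

/-! ### The pointwise energy inequality -/

set_option maxHeartbeats 1000000 in
/-- The pointwise difference of the integrands of the weak formulations, tested with a function of
the form `w^(2n+1) η^(2n+2)` where `∇w = U - V` and `∇η = Z`, dominates the weighted energy density
up to terms of order zero. -/
lemma exists_pointwise_lower_bound (n : ℕ) {p q γ M La Lb Lf K : ℝ} (hp1 : 1 < p) (hp2 : p < 2)
    (hq1 : 1 < q) (hγ : 0 < γ) (hM : 0 < M) (hLa : 0 < La) (hLb : 0 < Lb)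
    (hLf : 0 < Lf) (hK : 0 < K) :
    ∃ c C : ℝ, 0 < c ∧ 0 < C ∧
      ∀ (E : Type) [NormedAddCommGroup E] [InnerProductSpace ℝ E] (U V Z : E)
        (a₁ a₂ b₁ b₂ f₁ f₂ w η d : ℝ), ‖U‖ ≤ M → ‖V‖ ≤ M → ‖Z‖ ≤ 2 * d →
        0 ≤ w → 0 ≤ η → η ≤ 1 → 0 ≤ d → d ≤ 1 →
        γ ≤ a₁ → |a₁| ≤ K → |a₂| ≤ K → |b₁| ≤ K →
        |a₁ - a₂| ≤ La * (w + d ^ 2) → |b₁ - b₂| ≤ Lb * (w + d ^ 2) →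
        |f₁ - f₂| ≤ Lf * (w + d ^ 2) →
        c * ((‖U‖ + ‖V‖) ^ (p - 2) * ‖U - V‖ ^ 2 * (w ^ (2 * n) * η ^ (2 * n + 2)))
            - C * ((w * η) ^ (2 * n + 2) + d ^ (2 * n + 2)) ≤
          (a₁ * inner ℝ ((‖U‖ ^ (p - 2)) • U)
              (((2 * n + 1) * w ^ (2 * n) * η ^ (2 * n + 2)) • (U - V)
                + ((2 * n + 2) * w ^ (2 * n + 1) * η ^ (2 * n + 1)) • Z)
            + (b₁ * ‖U‖ ^ q - f₁) * (w ^ (2 * n + 1) * η ^ (2 * n + 2)))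
          - (a₂ * inner ℝ ((‖V‖ ^ (p - 2)) • V)
              (((2 * n + 1) * w ^ (2 * n) * η ^ (2 * n + 2)) • (U - V)
                + ((2 * n + 2) * w ^ (2 * n + 1) * η ^ (2 * n + 1)) • Z)
            + (b₂ * ‖V‖ ^ q - f₂) * (w ^ (2 * n + 1) * η ^ (2 * n + 2))) := by
  -- The leading term supplies `2c`; the two uses of Young's inequality, in `t2` and `t4`, cost `c /
  -- 2` each and leave `c`.
  set c : ℝ := γ * (p - 1) / 2 with hc_def
  have hc : 0 < c := by have : 0 < p - 1 := by linarith
                        positivity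
  set k₁ : ℝ := La * (2 * n + 1) with hk₁
  set C₁ : ℝ := k₁ ^ 2 * (2 * M) ^ p / (2 * c) with hC₁
  set C₁' : ℝ := k₁ * (M ^ (p - 1) * (2 * M)) with hC₁'
  set C₂ : ℝ := 2 * K * M ^ (p - 1) * 2 * (2 * n + 2) with hC₂
  set C₃ : ℝ := K ^ 2 * (q ^ 2 * (2 * M) ^ (2 * q - p)) / (2 * c) with hC₃
  set C₄ : ℝ := Lb * M ^ q + Lf with hC₄
  have hC₁0 : 0 ≤ C₁ := by positivity
  have hC₁'0 : 0 ≤ C₁' := by positivity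
  have hC₂0 : 0 ≤ C₂ := by positivity
  have hC₃0 : 0 ≤ C₃ := by positivity
  have hC₄0 : 0 ≤ C₄ := by positivity
  refine ⟨c, C₁ + C₁' + C₂ + C₃ + 2 * C₄ + 1, hc, by positivity, ?_⟩
  intro E _ _ U V Z a₁ a₂ b₁ b₂ f₁ f₂ w η d hU hV hZ hw hη hη1 hd hd1 ha₁ ha₁K ha₂K hb₁K hla hlb hlf
  set P : ℝ := (‖U‖ + ‖V‖) ^ (p - 2) * ‖U - V‖ ^ 2 with hP
  have hP0 : 0 ≤ P := by positivity
  set A : E := (‖U‖ ^ (p - 2)) • U with hA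
  set B : E := (‖V‖ ^ (p - 2)) • V with hB
  have hAn : ‖A‖ ≤ M ^ (p - 1) := by
    rw [hA, norm_flux hp1]; exact Real.rpow_le_rpow (norm_nonneg _) hU (by linarith)
  have hBn' : ‖B‖ = ‖V‖ ^ (p - 1) := norm_flux hp1 V
  have hBn : ‖B‖ ≤ M ^ (p - 1) := by
    rw [hBn']; exact Real.rpow_le_rpow (norm_nonneg _) hV (by linarith)
  have hDs : ‖U - V‖ ≤ ‖U‖ + ‖V‖ := norm_sub_le U V
  have hs : ‖U‖ + ‖V‖ ≤ 2 * M := by linarith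
  have hs0 : 0 ≤ ‖U‖ + ‖V‖ := by positivity
  set W : ℝ := w ^ (2 * n) * η ^ (2 * n + 2) with hW
  have hW0 : 0 ≤ W := by positivity
  set T : ℝ := (w * η) ^ (2 * n + 2) with hT
  set Δ : ℝ := d ^ (2 * n + 2) with hΔ
  have hT0 : 0 ≤ T := by positivity
  have hΔ0 : 0 ≤ Δ := by positivity
  have hWw : w ^ 2 * W = T := by rw [hW, hT]; ring
  -- This is where `δ = d²` pays off: the shift error multiplies `W`, of degree `2n` in `wη` after
  -- surplus factors of `η ≤ 1` are dropped, so `d²` restores degree `2n + 2`.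
  have hWd : d ^ 2 * W ≤ T + Δ := by
    have h1 : W ≤ (w * η) ^ (2 * n) := by
      rw [hW, mul_pow]
      exact mul_le_mul_of_nonneg_left (pow_le_pow_of_le_one hη hη1 (by omega)) (by positivity)
    have h2 := pow_mul_pow_le_add (mul_nonneg hw hη) hd (2 * n) 2
    have h3 : d ^ 2 * W ≤ d ^ 2 * (w * η) ^ (2 * n) := by gcongr
    linarith
  set φ : ℝ := w ^ (2 * n + 1) * η ^ (2 * n + 2) with hφ
  have hφ0 : 0 ≤ φ := by positivity
  have hφw : w * φ = T := by rw [hφ, hT]; ring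
  have hφW : φ = w * W := by rw [hφ, hW]; ring
  set H : ℝ := w ^ (2 * n + 1) * η ^ (2 * n + 1) with hH
  have hH0 : 0 ≤ H := by positivity
  -- The cutoff gradient contributes one factor `d` against degree `2n + 1`.
  have hHd : d * H ≤ T + Δ := by
    have h2 := pow_mul_pow_le_add (mul_nonneg hw hη) hd (2 * n + 1) 1
    have : H = (w * η) ^ (2 * n + 1) := by rw [hH, mul_pow]
    rw [this]; linarith
  have hφd : d ^ 2 * φ ≤ T + Δ := by
    have h1 : φ ≤ H := by
      rw [hφ, hH]
      exact mul_le_mul_of_nonneg_left (pow_le_pow_of_le_one hη hη1 (by omega)) (by positivity)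
    have h2 : d ^ 2 ≤ d := pow_le_of_le_one hd hd1 two_ne_zero
    calc d ^ 2 * φ ≤ d * H := by gcongr
      _ ≤ _ := hHd
  -- the leading term
  have t1 : 2 * c * (P * W) ≤ a₁ * (2 * n + 1) * W * inner ℝ (A - B) (U - V) := by
    have h1 : (p - 1) * P ≤ inner ℝ (A - B) (U - V) := flux_coercive hp1 hp2 U V
    have h0 : 0 ≤ (p - 1) * P := mul_nonneg (by linarith) hP0
    have h2 : γ ≤ a₁ * (2 * n + 1) := by
      have : (0 : ℝ) ≤ n := by positivity
      exact ha₁.trans (le_mul_of_one_le_right (hγ.le.trans ha₁) (by linarith))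
    calc 2 * c * (P * W) = γ * W * ((p - 1) * P) := by rw [hc_def]; ring
      _ ≤ (a₁ * (2 * n + 1)) * W * inner ℝ (A - B) (U - V) :=
          mul_le_mul (by gcongr) h1 h0 (mul_nonneg (hγ.le.trans h2) hW0)
      _ = _ := by ring
  -- the dependence of `a` on the second variable
  have t2 : |(a₁ - a₂) * (2 * n + 1) * W * inner ℝ B (U - V)|
      ≤ c / 2 * (P * W) + (C₁ + C₁') * (T + Δ) := by
    set Y : ℝ := ‖V‖ ^ (p - 1) * ‖U - V‖ with hY
    have hin : |inner ℝ B (U - V)| ≤ Y := by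
      rw [hY, ← hBn']; exact abs_real_inner_le_norm _ _
    have hYsq : Y ^ 2 ≤ (2 * M) ^ p * P := by
      have := sq_rpow_mul_le (p := p) (e := p) hs0 hs (by linarith) hDs (norm_nonneg _)
      rw [show 2 * p - p = p by ring] at this
      refine le_trans ?_ this
      rw [hY]
      gcongr
      linarith [norm_nonneg U]
    have hY2 : Y ≤ M ^ (p - 1) * (2 * M) := by
      rw [hY, ← hBn']; exact mul_le_mul hBn (hDs.trans hs) (norm_nonneg _) (by positivity)
    have hyoung : k₁ * w * Y ≤ c / 2 * P + C₁ * w ^ 2 :=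
      weighted_young hc hP0 (by positivity) hYsq
    have hn0 : (0 : ℝ) ≤ 2 * n + 1 := by positivity
    calc |(a₁ - a₂) * (2 * n + 1) * W * inner ℝ B (U - V)|
        = |a₁ - a₂| * (2 * n + 1) * W * |inner ℝ B (U - V)| := by
          rw [abs_mul, abs_mul, abs_mul, abs_of_nonneg hn0, abs_of_nonneg hW0]
      _ ≤ (La * (w + d ^ 2)) * (2 * n + 1) * W * Y := by gcongr
      _ = W * (k₁ * w * Y) + k₁ * Y * (d ^ 2 * W) := by rw [hk₁]; ring
      _ ≤ W * (c / 2 * P + C₁ * w ^ 2) + k₁ * (M ^ (p - 1) * (2 * M)) * (T + Δ) := by gcongr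
      _ = c / 2 * (P * W) + C₁ * (w ^ 2 * W) + C₁' * (T + Δ) := by rw [hC₁']; ring
      _ ≤ _ := by rw [hWw]; linarith [mul_nonneg hC₁0 hΔ0]
  -- the cutoff
  have t3 : |(2 * n + 2) * H * (a₁ * inner ℝ A Z - a₂ * inner ℝ B Z)| ≤ C₂ * (T + Δ) := by
    have hn0 : (0 : ℝ) ≤ (2 * n + 2) * H := by positivity
    have h1 : |inner ℝ A Z| ≤ M ^ (p - 1) * (2 * d) :=
      (abs_real_inner_le_norm A Z).trans (mul_le_mul hAn hZ (norm_nonneg _) (by positivity))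
    have h2 : |inner ℝ B Z| ≤ M ^ (p - 1) * (2 * d) :=
      (abs_real_inner_le_norm B Z).trans (mul_le_mul hBn hZ (norm_nonneg _) (by positivity))
    rw [abs_mul, abs_of_nonneg hn0]
    calc (2 * n + 2) * H * |a₁ * inner ℝ A Z - a₂ * inner ℝ B Z|
        ≤ (2 * n + 2) * H * (|a₁| * |inner ℝ A Z| + |a₂| * |inner ℝ B Z|) := by
          gcongr; rw [← abs_mul, ← abs_mul]; exact abs_sub _ _
      _ ≤ (2 * n + 2) * H * (K * (M ^ (p - 1) * (2 * d)) + K * (M ^ (p - 1) * (2 * d))) := by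
          gcongr
      _ = C₂ * (d * H) := by rw [hC₂]; ring
      _ ≤ _ := by gcongr
  -- the lower order terms
  have t4 : |b₁ * (‖U‖ ^ q - ‖V‖ ^ q) * φ| ≤ c / 2 * (P * W) + C₃ * (T + Δ) := by
    set Y : ℝ := |‖U‖ ^ q - ‖V‖ ^ q| with hY
    have hYsq : Y ^ 2 ≤ (q ^ 2 * (2 * M) ^ (2 * q - p)) * P := by
      have h1 := sq_rpow_mul_le (p := p) (e := q) hs0 hs (by linarith) hDs (norm_nonneg _)
      have h2 := abs_norm_rpow_sub_norm_rpow_le hq1.le U V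
      calc Y ^ 2 ≤ (q * (‖U‖ + ‖V‖) ^ (q - 1) * ‖U - V‖) ^ 2 := by gcongr
        _ = q ^ 2 * ((‖U‖ + ‖V‖) ^ (q - 1) * ‖U - V‖) ^ 2 := by ring
        _ ≤ q ^ 2 * ((2 * M) ^ (2 * q - p) * P) := by gcongr
        _ = _ := by ring
    have hyoung : K * w * Y ≤ c / 2 * P + C₃ * w ^ 2 :=
      weighted_young hc hP0 (by positivity) hYsq
    calc |b₁ * (‖U‖ ^ q - ‖V‖ ^ q) * φ| = |b₁| * Y * φ := by
          rw [abs_mul, abs_mul, abs_of_nonneg hφ0]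
      _ ≤ K * Y * φ := by gcongr
      _ = W * (K * w * Y) := by rw [hφW]; ring
      _ ≤ W * (c / 2 * P + C₃ * w ^ 2) := by gcongr
      _ = c / 2 * (P * W) + C₃ * (w ^ 2 * W) := by ring
      _ ≤ _ := by rw [hWw]; linarith [mul_nonneg hC₃0 hΔ0]
  have hwφ : (w + d ^ 2) * φ ≤ 2 * (T + Δ) := by
    have : (w + d ^ 2) * φ = w * φ + d ^ 2 * φ := by ring
    linarith
  have t5 : |((b₁ - b₂) * ‖V‖ ^ q - (f₁ - f₂)) * φ| ≤ 2 * C₄ * (T + Δ) := by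
    rw [abs_mul, abs_of_nonneg hφ0]
    calc |(b₁ - b₂) * ‖V‖ ^ q - (f₁ - f₂)| * φ
        ≤ (|b₁ - b₂| * ‖V‖ ^ q + |f₁ - f₂|) * φ := by
          gcongr
          refine (abs_sub _ _).trans_eq ?_
          rw [abs_mul, abs_of_nonneg (a := ‖V‖ ^ q) (by positivity)]
      _ ≤ (Lb * (w + d ^ 2) * M ^ q + Lf * (w + d ^ 2)) * φ := by gcongr
      _ = C₄ * ((w + d ^ 2) * φ) := by rw [hC₄]; ring
      _ ≤ C₄ * (2 * (T + Δ)) := by gcongr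
      _ = _ := by ring
  have key : (a₁ * inner ℝ A (((2 * n + 1) * w ^ (2 * n) * η ^ (2 * n + 2)) • (U - V)
                + ((2 * n + 2) * w ^ (2 * n + 1) * η ^ (2 * n + 1)) • Z)
            + (b₁ * ‖U‖ ^ q - f₁) * φ)
          - (a₂ * inner ℝ B (((2 * n + 1) * w ^ (2 * n) * η ^ (2 * n + 2)) • (U - V)
                + ((2 * n + 2) * w ^ (2 * n + 1) * η ^ (2 * n + 1)) • Z)
            + (b₂ * ‖V‖ ^ q - f₂) * φ)
      = a₁ * (2 * n + 1) * W * inner ℝ (A - B) (U - V)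
        + (a₁ - a₂) * (2 * n + 1) * W * inner ℝ B (U - V)
        + (2 * n + 2) * H * (a₁ * inner ℝ A Z - a₂ * inner ℝ B Z)
        + b₁ * (‖U‖ ^ q - ‖V‖ ^ q) * φ
        + ((b₁ - b₂) * ‖V‖ ^ q - (f₁ - f₂)) * φ := by
    simp only [inner_add_right, inner_smul_right, inner_sub_left, hW, hH]
    ring
  rw [key]
  have r2 := (abs_le.1 t2).1
  have r3 := (abs_le.1 t3).1
  have r4 := (abs_le.1 t4).1
  have r5 := (abs_le.1 t5).1
  have hfin : (C₁ + C₁' + C₂ + C₃ + 2 * C₄ + 1) * (T + Δ)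
      = (C₁ + C₁') * (T + Δ) + C₂ * (T + Δ) + C₃ * (T + Δ) + 2 * C₄ * (T + Δ) + (T + Δ) := by ring
  linarith

/-! ### From smooth to `C¹` test functions -/

lemma norm_gradient_sub_gradient {n : ℕ} (φ ψ : Space n → ℝ) (x y : Space n) :
    ‖∇ φ x - ∇ ψ y‖ = ‖fderiv ℝ φ x - fderiv ℝ ψ y‖ := by
  rw [gradient, gradient, ← map_sub, LinearIsometryEquiv.norm_map]

lemma continuous_gradient {n : ℕ} {φ : Space n → ℝ} (hφ : ContDiff ℝ 1 φ) :
    Continuous fun x => ∇ φ x :=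
  (InnerProductSpace.toDual ℝ (Space n)).symm.continuous.comp (hφ.continuous_fderiv one_ne_zero)

lemma gradient_eq_zero_of_notMem_tsupport {n : ℕ} {φ : Space n → ℝ} {x : Space n}
    (hx : x ∉ tsupport φ) : ∇ φ x = 0 := by
  have : fderiv ℝ φ x = 0 := by
    by_contra h
    exact hx (support_fderiv_subset ℝ h)
  rw [gradient, this, map_zero]

/-- Nonnegative `C^1` functions with compact support are limits, in the `C^1` norm and with supports
in a fixed compact set, of nonnegative test functions. -/
lemma exists_isNonnegTest_approx {n : ℕ} {Ω : Set (Space n)} (hΩ : IsOpen Ω) {φ : Space n → ℝ}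
    (hφ : ContDiff ℝ 1 φ) (hc : HasCompactSupport φ) (hs : tsupport φ ⊆ Ω) (h0 : ∀ x, 0 ≤ φ x) :
    ∃ K : Set (Space n), IsCompact K ∧ K ⊆ Ω ∧ tsupport φ ⊆ K ∧
      ∀ e : ℝ, 0 < e → ∃ ψ : Space n → ℝ, IsNonnegTest Ω ψ ∧ tsupport ψ ⊆ K ∧
        ∀ x, |ψ x - φ x| ≤ e ∧ ‖∇ ψ x - ∇ φ x‖ ≤ e := by
  obtain ⟨r, hr, hrΩ⟩ := hc.isCompact.exists_cthickening_subset_open hΩ hs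
  have hK : IsCompact (Metric.cthickening r (tsupport φ)) := hc.isCompact.cthickening
  refine ⟨_, hK, hrΩ, Metric.self_subset_cthickening _, fun e he => ?_⟩
  have hu : UniformContinuous φ := hφ.continuous.uniformContinuous_of_tendsto_cocompact
    (hc.is_zero_at_infty)
  have hu' : UniformContinuous (fderiv ℝ φ) :=
    (hφ.continuous_fderiv one_ne_zero).uniformContinuous_of_tendsto_cocompact
      (hc.fderiv ℝ).is_zero_at_infty
  obtain ⟨r₁, hr₁, h₁⟩ := Metric.uniformContinuous_iff.1 hu e he
  obtain ⟨r₂, hr₂, h₂⟩ := Metric.uniformContinuous_iff.1 hu' e he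
  -- The bound `r` keeps the mollified support in the compact thickening; `r₁` and `r₂` are moduli
  -- of continuity of `φ` and of its derivative.
  set ρ := min r (min r₁ r₂)
  have hρ : 0 < ρ := lt_min hr (lt_min hr₁ hr₂)
  let ζ : ContDiffBump (0 : Space n) := ⟨ρ / 2, ρ, half_pos hρ, half_lt_self hρ⟩
  set ψ : Space n → ℝ :=
    MeasureTheory.convolution (ζ.normed volume) φ (ContinuousLinearMap.lsmul ℝ ℝ) volume with hψ
  have hψs : tsupport ψ ⊆ Metric.cthickening r (tsupport φ) := by
    refine closure_minimal ?_ Metric.isClosed_cthickening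
    refine (support_convolution_subset (ContinuousLinearMap.lsmul ℝ ℝ)).trans ?_
    rw [ζ.support_normed_eq]
    rintro _ ⟨y, hy, z, hz, rfl⟩
    refine Metric.mem_cthickening_of_dist_le _ z _ _ (subset_tsupport _ hz) ?_
    rw [Metric.mem_ball, dist_zero_right] at hy
    have : ‖y‖ < ρ := hy
    simp only [dist_eq_norm, add_sub_cancel_right]
    exact this.le.trans (min_le_left _ _)
  -- The derivative is placed on `φ`, so the gradient error is again a mollification error.
  have hfd : ∀ x, fderiv ℝ ψ x = MeasureTheory.convolution (ζ.normed volume) (fderiv ℝ φ)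
      (ContinuousLinearMap.lsmul ℝ ℝ) volume x := by
    intro x
    exact (hc.hasFDerivAt_convolution_right (ContinuousLinearMap.lsmul ℝ ℝ)
      ζ.integrable_normed.locallyIntegrable hφ x).fderiv
  refine ⟨ψ, ⟨?_, hK.of_isClosed_subset (isClosed_tsupport _) hψs, hψs.trans hrΩ, ?_⟩, hψs, ?_⟩
  · exact ζ.hasCompactSupport_normed.contDiff_convolution_left _ ζ.contDiff_normed
      hφ.continuous.locallyIntegrable
  · intro x
    exact integral_nonneg fun t => mul_nonneg (ζ.nonneg_normed t) (h0 _)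
  · intro x
    constructor
    · rw [← Real.dist_eq]
      refine ζ.dist_normed_convolution_le hφ.continuous.aestronglyMeasurable fun y hy => ?_
      exact (h₁ ((Metric.mem_ball.1 hy).trans_le
        ((min_le_right _ _).trans (min_le_left _ _)))).le
    · rw [norm_gradient_sub_gradient, hfd, ← dist_eq_norm]
      refine ζ.dist_normed_convolution_le
        (hφ.continuous_fderiv one_ne_zero).aestronglyMeasurable fun y hy => ?_
      exact (h₂ ((Metric.mem_ball.1 hy).trans_le
        ((min_le_right _ _).trans (min_le_right _ _)))).le

/-- The integrand of a weak formulation in divergence form. -/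
def divForm {n : ℕ} (F : Space n → Space n) (h φ : Space n → ℝ) (x : Space n) : ℝ :=
  inner ℝ (F x) (∇ φ x) + h x * φ x

lemma divForm_eq_zero {n : ℕ} {F : Space n → Space n} {h φ : Space n → ℝ} {x : Space n}
    (hx : x ∉ tsupport φ) : divForm F h φ x = 0 := by
  rw [divForm, gradient_eq_zero_of_notMem_tsupport hx, image_eq_zero_of_notMem_tsupport hx]
  simp

lemma continuousOn_divForm {n : ℕ} {s : Set (Space n)} {F : Space n → Space n}
    {h φ : Space n → ℝ} (hF : ContinuousOn F s) (hh : ContinuousOn h s) (hφ : ContDiff ℝ 1 φ) :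
    ContinuousOn (divForm F h φ) s :=
  (hF.inner (𝕜 := ℝ) (continuous_gradient hφ).continuousOn).add (hh.mul hφ.continuous.continuousOn)

lemma integrable_divForm {n : ℕ} {Ω : Set (Space n)} {F : Space n → Space n}
    {h φ : Space n → ℝ} (hF : ContinuousOn F Ω) (hh : ContinuousOn h Ω) (hφ : ContDiff ℝ 1 φ)
    (hc : HasCompactSupport φ) (hs : tsupport φ ⊆ Ω) : Integrable (divForm F h φ) := by
  rw [← integrableOn_iff_integrable_of_support_subset (s := tsupport φ)]
  · exact ((continuousOn_divForm hF hh hφ).mono hs).integrableOn_compact hc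
  · intro x hx
    by_contra h'
    exact hx (divForm_eq_zero h')

/-- A weak inequality that holds for smooth nonnegative test functions holds for `C^1` ones. -/
lemma setIntegral_divForm_nonpos {n : ℕ} {Ω : Set (Space n)} (hΩ : IsOpen Ω)
    {F : Space n → Space n} {h : Space n → ℝ} (hF : ContinuousOn F Ω) (hh : ContinuousOn h Ω)
    (H : ∀ φ, IsNonnegTest Ω φ → ∫ x in Ω, divForm F h φ x ≤ 0) {φ : Space n → ℝ}
    (hφ : ContDiff ℝ 1 φ) (hc : HasCompactSupport φ) (hs : tsupport φ ⊆ Ω) (h0 : ∀ x, 0 ≤ φ x) :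
    ∫ x in Ω, divForm F h φ x ≤ 0 := by
  obtain ⟨K, hK, hKΩ, hφK, happ⟩ := exists_isNonnegTest_approx hΩ hφ hc hs h0
  set B : ℝ := ∫ x in K, (‖F x‖ + |h x|)
  have hBint : IntegrableOn (fun x => ‖F x‖ + |h x|) K :=
    (((hF.mono hKΩ).norm).add (hh.mono hKΩ).abs).integrableOn_compact hK
  have hB : 0 ≤ B := integral_nonneg fun x => by positivity
  have key : ∀ e : ℝ, 0 < e → ∫ x in Ω, divForm F h φ x ≤ e * B := by
    intro e he
    obtain ⟨ψ, hψ, hψK, hclose⟩ := happ e he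
    have hψ1 : ContDiff ℝ 1 ψ := hψ.1.of_le (by norm_cast)
    have e1 : ∫ x in Ω, divForm F h φ x = ∫ x in K, divForm F h φ x :=
      setIntegral_eq_of_subset_of_forall_sdiff_eq_zero hΩ.measurableSet hKΩ
        fun x hx => divForm_eq_zero fun hx' => hx.2 (hφK hx')
    have e2 : ∫ x in Ω, divForm F h ψ x = ∫ x in K, divForm F h ψ x :=
      setIntegral_eq_of_subset_of_forall_sdiff_eq_zero hΩ.measurableSet hKΩ
        fun x hx => divForm_eq_zero fun hx' => hx.2 (hψK hx')
    have i1 := (integrable_divForm hF hh hφ hc hs).integrableOn (s := K)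
    have i2 := (integrable_divForm hF hh hψ1 hψ.2.1 hψ.2.2.1).integrableOn (s := K)
    rw [e1]
    calc ∫ x in K, divForm F h φ x
        ≤ ∫ x in K, (divForm F h ψ x + e * (‖F x‖ + |h x|)) := by
          refine integral_mono i1 (i2.add (hBint.const_mul e)) fun x => ?_
          have h1 : divForm F h φ x
              = divForm F h ψ x - (inner ℝ (F x) (∇ ψ x - ∇ φ x) + h x * (ψ x - φ x)) := by
            simp only [divForm, inner_sub_right]; ring
          have h2 : |inner ℝ (F x) (∇ ψ x - ∇ φ x)| ≤ ‖F x‖ * e :=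
            (abs_real_inner_le_norm _ _).trans (by gcongr; exact (hclose x).2)
          have h3 : |h x * (ψ x - φ x)| ≤ |h x| * e := by
            rw [abs_mul]; gcongr; exact (hclose x).1
          have h4 := (abs_le.1 h2).1
          have h5 := (abs_le.1 h3).1
          simp only
          rw [h1]
          linarith
      _ = (∫ x in Ω, divForm F h ψ x) + e * B := by
          rw [integral_add i2 (hBint.const_mul e), integral_const_mul, e2]
      _ ≤ e * B := by linarith [H ψ hψ]
  refine le_of_forall_pos_le_add fun δ hδ => ?_
  -- The denominator is `B + 1` because `B` may vanish.
  refine (key (δ / (B + 1)) (by positivity)).trans ?_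
  rw [zero_add, div_mul_eq_mul_div, div_le_iff₀ (by positivity)]
  nlinarith

/-! ### Regularity of the data, truncations and the horizontal cutoff -/

lemma isOpen_strip {n : ℕ} (lam y₀ : ℝ) : IsOpen (strip n lam y₀) :=
  isOpen_Ioo.preimage (EuclideanSpace.proj (𝕜 := ℝ) (Fin.last n)).continuous

lemma C1HolderLocClosure.continuousOn_gradient {n : ℕ} {α : ℝ≥0} (hα : 0 < α)
    {Ω : Set (Space n)} (hΩ : IsOpen Ω) {u : Space n → ℝ} (hu : C1HolderLocClosure α Ω u) :
    ContinuousOn (fun x => ∇ u x) Ω := by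
  intro x hx
  obtain ⟨r, hr, hrΩ⟩ := Metric.nhds_basis_closedBall.mem_iff.1 (hΩ.mem_nhds hx)
  obtain ⟨C, hC⟩ := hu.2.2 _ (isCompact_closedBall x r) (hrΩ.trans subset_closure)
  rw [inter_eq_left.2 hrΩ] at hC
  exact ((hC.continuousOn hα).continuousAt (Metric.closedBall_mem_nhds x hr)).continuousWithinAt

lemma C1HolderLocClosure.contDiffAt {n : ℕ} {α : ℝ≥0} (hα : 0 < α)
    {Ω : Set (Space n)} (hΩ : IsOpen Ω) {u : Space n → ℝ} (hu : C1HolderLocClosure α Ω u)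
    {x : Space n} (hx : x ∈ Ω) : ContDiffAt ℝ 1 u x := by
  rw [contDiffAt_one_iff]
  refine ⟨fderiv ℝ u, Ω, hΩ.mem_nhds hx, ?_, fun y hy =>
    (hu.2.1.differentiableAt (hΩ.mem_nhds hy)).hasFDerivAt⟩
  have := (InnerProductSpace.toDual ℝ (Space n)).continuous.comp_continuousOn
    (hu.continuousOn_gradient hα hΩ)
  refine this.congr fun y _ => ?_
  simp [gradient]

/-- The power `k + 1 ≥ 2` removes the corner of the positive part: at `0` the function is
`O(|s|^(k+1)) = o(s)`. Hence truncated tests are genuinely `C¹` and no Sobolev theory is needed. -/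
lemma hasDerivAt_max_zero_pow {k : ℕ} (hk : 1 ≤ k) (t : ℝ) :
    HasDerivAt (fun s : ℝ => max s 0 ^ (k + 1)) ((k + 1) * max t 0 ^ k) t := by
  rcases lt_trichotomy t 0 with ht | ht | ht
  · rw [max_eq_right ht.le, zero_pow (by omega), mul_zero]
    refine (hasDerivAt_const t (0 : ℝ)).congr_of_eventuallyEq ?_
    filter_upwards [gt_mem_nhds ht] with s hs
    rw [max_eq_right hs.le, zero_pow (by omega)]
  · subst ht
    rw [max_self, zero_pow (by omega), mul_zero, hasDerivAt_iff_isLittleO]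
    simp only [max_self, sub_zero, smul_zero]
    rw [zero_pow (by omega : k + 1 ≠ 0)]
    simp only [sub_zero]
    have h : (fun s : ℝ => s ^ (k + 1)) =o[nhds 0] fun s : ℝ => s := by
      simpa using Asymptotics.isLittleO_pow_pow (𝕜 := ℝ) (m := 1) (n := k + 1) (by omega)
    refine Asymptotics.IsBigO.trans_isLittleO ?_ h
    refine Asymptotics.IsBigO.of_bound 1 (Filter.Eventually.of_forall fun s => ?_)
    rw [one_mul, norm_pow, norm_pow, Real.norm_eq_abs, Real.norm_eq_abs]
    refine pow_le_pow_left₀ (abs_nonneg _) ?_ _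
    rcases le_total s 0 with h | h
    · simp [h]
    · simp [h]
  · rw [max_eq_left ht.le]
    have := hasDerivAt_pow (k + 1) t
    simp only [Nat.cast_add, Nat.cast_one, Nat.add_sub_cancel] at this
    refine this.congr_of_eventuallyEq ?_
    filter_upwards [lt_mem_nhds ht] with s hs
    rw [max_eq_left hs.le]

lemma contDiff_max_zero_pow {k : ℕ} (hk : 1 ≤ k) :
    ContDiff ℝ 1 (fun s : ℝ => max s 0 ^ (k + 1)) := by
  rw [contDiff_one_iff_deriv]
  refine ⟨fun t => (hasDerivAt_max_zero_pow hk t).differentiableAt, ?_⟩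
  rw [show deriv (fun s : ℝ => max s 0 ^ (k + 1)) = fun t : ℝ => (k + 1) * max t 0 ^ k from
    funext fun t => (hasDerivAt_max_zero_pow hk t).deriv]
  fun_prop

/-- `|x'|^2` for `x = (x', y)`. -/
def horizSq {n : ℕ} (x : Space n) : ℝ := ∑ i : Fin n, x i.castSucc ^ 2

/-- The differential of `1 - d^2 |x'|^2`. -/
def horizDeriv {n : ℕ} (d : ℝ) (x : Space n) : Space n →L[ℝ] ℝ :=
  -(d ^ 2 • ∑ i : Fin n, (2 * x i.castSucc) • EuclideanSpace.proj (𝕜 := ℝ) i.castSucc)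

lemma horizSq_nonneg {n : ℕ} (x : Space n) : 0 ≤ horizSq x :=
  Finset.sum_nonneg fun _ _ => sq_nonneg _

lemma norm_sq_eq_horizSq_add {n : ℕ} (x : Space n) :
    ‖x‖ ^ 2 = horizSq x + x (Fin.last n) ^ 2 := by
  rw [EuclideanSpace.real_norm_sq_eq, Fin.sum_univ_castSucc, horizSq]

lemma continuous_horizSq {n : ℕ} : Continuous (horizSq (n := n)) := by
  unfold horizSq; fun_prop

lemma contDiff_horiz {n : ℕ} (d : ℝ) : ContDiff ℝ 1 fun x : Space n => 1 - d ^ 2 * horizSq x := by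
  unfold horizSq; fun_prop

lemma hasFDerivAt_horiz {n : ℕ} (d : ℝ) (x : Space n) :
    HasFDerivAt (fun y : Space n => 1 - d ^ 2 * horizSq y) (horizDeriv d x) x := by
  unfold horizSq horizDeriv
  have h : ∀ i : Fin n, HasFDerivAt (fun y : Space n => y i.castSucc ^ 2)
      ((2 * x i.castSucc) • EuclideanSpace.proj (𝕜 := ℝ) i.castSucc) x := by
    intro i
    have := ((EuclideanSpace.proj (𝕜 := ℝ) i.castSucc : Space n →L[ℝ] ℝ).hasFDerivAt
      (x := x)).pow 2
    simpa using this
  exact ((HasFDerivAt.fun_sum fun i _ => h i).const_mul (d ^ 2)).const_sub 1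

lemma horizDeriv_apply {n : ℕ} (d : ℝ) (x z : Space n) :
    horizDeriv d x z = -(d ^ 2 * ∑ i : Fin n, 2 * x i.castSucc * z i.castSucc) := by
  simp [horizDeriv]

/-- By Cauchy–Schwarz the differential has size at most `2 d² |x'|`, and `d |x'| ≤ 1` where the
cutoff lives. -/
lemma norm_horizDeriv_le {n : ℕ} {d : ℝ} (hd : 0 ≤ d) {x : Space n} (hx : d ^ 2 * horizSq x ≤ 1) :
    ‖horizDeriv d x‖ ≤ 2 * d := by
  refine ContinuousLinearMap.opNorm_le_bound _ (by positivity) fun z => ?_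
  rw [horizDeriv_apply, norm_neg, Real.norm_eq_abs]
  refine abs_le_of_sq_le_sq ?_ (by positivity)
  have hcs := Finset.sum_mul_sq_le_sq_mul_sq Finset.univ (fun i : Fin n => x i.castSucc)
    (fun i : Fin n => z i.castSucc)
  have hz : (∑ i : Fin n, z i.castSucc ^ 2) ≤ ‖z‖ ^ 2 := by
    rw [norm_sq_eq_horizSq_add z, horizSq]; nlinarith [sq_nonneg (z (Fin.last n))]
  have hx0 := horizSq_nonneg x
  have e : ∑ i : Fin n, 2 * x i.castSucc * z i.castSucc
      = 2 * ∑ i : Fin n, x i.castSucc * z i.castSucc := by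
    rw [Finset.mul_sum]; exact Finset.sum_congr rfl fun i _ => by ring
  calc (d ^ 2 * ∑ i : Fin n, 2 * x i.castSucc * z i.castSucc) ^ 2
      = 4 * d ^ 4 * (∑ i : Fin n, x i.castSucc * z i.castSucc) ^ 2 := by rw [e]; ring
    _ ≤ 4 * d ^ 4 * (horizSq x * ‖z‖ ^ 2) := by
        gcongr
        exact hcs.trans (mul_le_mul_of_nonneg_left hz hx0)
    _ = 4 * d ^ 2 * (d ^ 2 * horizSq x) * ‖z‖ ^ 2 := by ring
    _ ≤ 4 * d ^ 2 * 1 * ‖z‖ ^ 2 := by gcongr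
    _ = (2 * d * ‖z‖) ^ 2 := by ring

/-- The cutoff does not depend on `y`, hence contributes nothing to the vertical derivative in the
Poincaré inequality. -/
lemma horizDeriv_single_last {n : ℕ} (d : ℝ) (x : Space n) :
    horizDeriv d x (EuclideanSpace.single (Fin.last n) 1) = 0 := by
  rw [horizDeriv_apply]
  simp [(Fin.castSucc_lt_last _).ne]

/-- The cutoff function `(1 - d^2 |x'|^2)^+`. -/
def cutoff {n : ℕ} (d : ℝ) (x : Space n) : ℝ := max (1 - d ^ 2 * horizSq x) 0

lemma cutoff_nonneg {n : ℕ} (d : ℝ) (x : Space n) : 0 ≤ cutoff d x := le_max_right _ _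

lemma cutoff_le_one {n : ℕ} (d : ℝ) (x : Space n) : cutoff d x ≤ 1 :=
  max_le (by nlinarith [horizSq_nonneg x, sq_nonneg d, mul_nonneg (sq_nonneg d) (horizSq_nonneg x)])
    zero_le_one

lemma continuous_cutoff {n : ℕ} (d : ℝ) : Continuous (cutoff (n := n) d) := by
  unfold cutoff; have := continuous_horizSq (n := n); fun_prop

/-- The truncated difference `1_S (u - v - δ)^+`. -/
def truncDiff {n : ℕ} (u v : Space n → ℝ) (S : Set (Space n)) (δ : ℝ) : Space n → ℝ :=
  S.indicator fun x => max (u x - v x - δ) 0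

lemma truncDiff_nonneg {n : ℕ} (u v : Space n → ℝ) (S : Set (Space n)) (δ : ℝ) (x : Space n) :
    0 ≤ truncDiff u v S δ x := indicator_nonneg (fun _ _ => le_max_right _ _) x

/-- The test function `w^(i+1) η^(j+1)` where `w = 1_S (u - v - δ)^+` and `η` is the cutoff. -/
def truncTest {n : ℕ} (u v : Space n → ℝ) (S : Set (Space n)) (δ d : ℝ) (i j : ℕ) (x : Space n) :
    ℝ :=
  truncDiff u v S δ x ^ (i + 1) * cutoff d x ^ (j + 1)

lemma truncTest_nonneg {n : ℕ} (u v : Space n → ℝ) (S : Set (Space n)) (δ d : ℝ) (i j : ℕ)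
    (x : Space n) : 0 ≤ truncTest u v S δ d i j x :=
  mul_nonneg (pow_nonneg (truncDiff_nonneg u v S δ x) _) (pow_nonneg (cutoff_nonneg d x) _)

/-- A set that contains the supports of the truncated test functions. -/
def truncSupport {n : ℕ} (u v : Space n → ℝ) (S : Set (Space n)) (δ d : ℝ) : Set (Space n) :=
  {x | x ∈ closure S ∧ δ ≤ u x - v x ∧ d ^ 2 * horizSq x ≤ 1}

section Truncation

variable {n : ℕ} {u v : Space n → ℝ} {S : Set (Space n)} {δ d lam y₀ : ℝ}

lemma mem_truncSupport_of_ne_zero {x : Space n} (hw : truncDiff u v S δ x ≠ 0)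
    (hη : cutoff d x ≠ 0) : x ∈ S ∧ x ∈ truncSupport u v S δ d := by
  have hx : x ∈ S := mem_of_indicator_ne_zero hw
  rw [truncDiff, indicator_of_mem hx] at hw
  refine ⟨hx, subset_closure hx, ?_, ?_⟩
  · by_contra h
    exact hw (max_eq_right (by linarith))
  · by_contra h
    exact hη (max_eq_right (by linarith))

/-- A point of `closure S` outside the open set `S` lies on the frontier, where `u - v ≤ 0 < δ`. -/
lemma truncSupport_subset (hδ : 0 < δ) (hS : IsOpen S) (hb : ∀ x ∈ frontier S, u x ≤ v x) :
    truncSupport u v S δ d ⊆ S := by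
  rintro x ⟨hx, hx1, -⟩
  by_contra h
  have := hb x ⟨hx, by rwa [hS.interior_eq]⟩
  linarith

lemma closure_subset_slab (hsub : S ⊆ strip n lam y₀) {x : Space n} (hx : x ∈ closure S) :
    x (Fin.last n) ∈ Icc (y₀ - lam / 2) (y₀ + lam / 2) := by
  have hc : IsClosed {x : Space n | x (Fin.last n) ∈ Icc (y₀ - lam / 2) (y₀ + lam / 2)} :=
    isClosed_Icc.preimage (EuclideanSpace.proj (𝕜 := ℝ) (Fin.last n)).continuous
  refine closure_minimal (fun y hy => ?_) hc hx
  exact Ioo_subset_Icc_self (show y (Fin.last n) ∈ Ioo _ _ from hsub hy)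

lemma isCompact_truncSupport (hd : 0 < d) (hsub : S ⊆ strip n lam y₀)
    (hu : ContinuousOn u (closure S)) (hv : ContinuousOn v (closure S)) :
    IsCompact (truncSupport u v S δ d) := by
  have hcl : IsClosed (truncSupport u v S δ d) := by
    have h1 : IsClosed (closure S ∩ (fun x => u x - v x) ⁻¹' Ici δ) :=
      (hu.sub hv).preimage_isClosed_of_isClosed isClosed_closure isClosed_Ici
    have h2 : IsClosed {x : Space n | d ^ 2 * horizSq x ≤ 1} :=
      isClosed_le (by have := continuous_horizSq (n := n); fun_prop) continuous_const
    convert h1.inter h2 using 1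
    ext x
    simp only [truncSupport, mem_ofPred_eq, mem_inter_iff, mem_preimage, mem_Ici, and_assoc]
  refine Metric.isCompact_of_isClosed_isBounded hcl ?_
  refine (isBounded_iff_forall_norm_le.2 ⟨1 / d + (|y₀| + |lam|), ?_⟩)
  rintro x ⟨hx, -, hx2⟩
  have hy := closure_subset_slab hsub hx
  have h3 : |x (Fin.last n)| ≤ |y₀| + |lam| := by
    rw [abs_le]
    constructor <;>
    linarith [hy.1, hy.2, neg_abs_le y₀, le_abs_self y₀, neg_abs_le lam, le_abs_self lam,
      abs_nonneg lam]
  have h4 : horizSq x ≤ (1 / d) ^ 2 := by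
    rw [one_div, inv_pow, ← one_div, le_div_iff₀ (by positivity)]; linarith
  refine (abs_le_of_sq_le_sq' ?_ (by positivity)).2
  rw [norm_sq_eq_horizSq_add]
  have h5 : x (Fin.last n) ^ 2 ≤ (|y₀| + |lam|) ^ 2 := by
    rw [← sq_abs (x _)]; gcongr
  have h6 : 0 ≤ 1 / d * (|y₀| + |lam|) := by positivity
  nlinarith

lemma truncTest_eq_zero {i j : ℕ} {x : Space n} (hx : x ∉ truncSupport u v S δ d) :
    truncTest u v S δ d i j x = 0 := by
  by_contra h
  refine hx (mem_truncSupport_of_ne_zero (fun hw => h ?_) fun hη => h ?_).2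
  · simp [truncTest, hw]
  · simp [truncTest, hη]

lemma tsupport_truncTest_subset (hd : 0 < d) (hsub : S ⊆ strip n lam y₀)
    (hu : ContinuousOn u (closure S)) (hv : ContinuousOn v (closure S)) (i j : ℕ) :
    tsupport (truncTest u v S δ d i j) ⊆ truncSupport u v S δ d := by
  refine closure_minimal (fun x hx => ?_) (isCompact_truncSupport hd hsub hu hv).isClosed
  by_contra h
  exact hx (truncTest_eq_zero h)

lemma truncTest_eventuallyEq (hS : IsOpen S) (i j : ℕ) {x : Space n} (hx : x ∈ S) :
    truncTest u v S δ d i j =ᶠ[nhds x]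
      fun y => max (u y - v y - δ) 0 ^ (i + 1) * max (1 - d ^ 2 * horizSq y) 0 ^ (j + 1) := by
  filter_upwards [hS.mem_nhds hx] with y hy
  rw [truncTest, truncDiff, indicator_of_mem hy, cutoff]

lemma contDiff_truncTest (hd : 0 < d) (hδ : 0 < δ) (hS : IsOpen S) (hsub : S ⊆ strip n lam y₀)
    (hb : ∀ x ∈ frontier S, u x ≤ v x)
    (hu : ContinuousOn u (closure S)) (hv : ContinuousOn v (closure S))
    (hu' : ∀ x ∈ S, ContDiffAt ℝ 1 u x) (hv' : ∀ x ∈ S, ContDiffAt ℝ 1 v x)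
    {i j : ℕ} (hi : 1 ≤ i) (hj : 1 ≤ j) : ContDiff ℝ 1 (truncTest u v S δ d i j) := by
  rw [contDiff_iff_contDiffAt]
  intro x
  by_cases hx : x ∈ S
  · refine ContDiffAt.congr_of_eventuallyEq ?_ (truncTest_eventuallyEq hS i j hx)
    refine ContDiffAt.mul ?_ ?_
    · exact (contDiff_max_zero_pow hi).contDiffAt.comp x
        (((hu' x hx).sub (hv' x hx)).sub contDiffAt_const)
    · exact (contDiff_max_zero_pow hj).contDiffAt.comp x (contDiff_horiz d).contDiffAt
  -- Off `S` the point avoids a closed set carrying the test function, which therefore vanishes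
  -- nearby. In particular, extension by zero across `∂S` is smooth.
  · have hK := (isCompact_truncSupport (δ := δ) hd hsub hu hv).isClosed.isOpen_compl.mem_nhds
      (fun h => hx (truncSupport_subset hδ hS hb h) : x ∈ (truncSupport u v S δ d)ᶜ)
    refine (contDiffAt_const (c := (0 : ℝ))).congr_of_eventuallyEq ?_
    filter_upwards [hK] with y hy
    exact truncTest_eq_zero hy

lemma fderiv_truncTest (hS : IsOpen S) {x : Space n} (hx : x ∈ S)
    (hu : DifferentiableAt ℝ u x) (hv : DifferentiableAt ℝ v x)
    {i j : ℕ} (hi : 1 ≤ i) (hj : 1 ≤ j) :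
    fderiv ℝ (truncTest u v S δ d i j) x =
      ((i + 1) * truncDiff u v S δ x ^ i * cutoff d x ^ (j + 1)) • (fderiv ℝ u x - fderiv ℝ v x)
      + ((j + 1) * truncDiff u v S δ x ^ (i + 1) * cutoff d x ^ j) • horizDeriv d x := by
  have h1 := (hasDerivAt_max_zero_pow hi (u x - v x - δ)).comp_hasFDerivAt x
    ((hu.hasFDerivAt.sub hv.hasFDerivAt).sub_const δ)
  have h2 := (hasDerivAt_max_zero_pow hj (1 - d ^ 2 * horizSq x)).comp_hasFDerivAt x
    (hasFDerivAt_horiz d x)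
  have h3 := ((h1.mul h2).congr_of_eventuallyEq (truncTest_eventuallyEq hS i j hx)).fderiv
  rw [h3, truncDiff, indicator_of_mem hx, cutoff]
  ext z
  simp
  ring

end Truncation

/-! ### Vertical sections and the weighted Poincaré inequality -/

@[simp] lemma point_last {n : ℕ} (x' : EuclideanSpace ℝ (Fin n)) (y : ℝ) :
    point x' y (Fin.last n) = y := by simp [point]

lemma point_eq_add_smul {n : ℕ} (x' : EuclideanSpace ℝ (Fin n)) (y : ℝ) :
    point x' y = point x' 0 + y • EuclideanSpace.single (Fin.last n) (1 : ℝ) := by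
  ext i
  refine Fin.lastCases ?_ (fun i => ?_) i
  · simp [point]
  · simp [point, (Fin.castSucc_lt_last i).ne]

lemma hasDerivAt_point {n : ℕ} (x' : EuclideanSpace ℝ (Fin n)) (y : ℝ) :
    HasDerivAt (fun y => point x' y) (EuclideanSpace.single (Fin.last n) (1 : ℝ)) y := by
  have h : (fun y => point x' y)
      = fun y => point x' 0 + y • EuclideanSpace.single (Fin.last n) (1 : ℝ) :=
    funext fun y => point_eq_add_smul x' y
  rw [h]
  simpa using ((hasDerivAt_id y).smul_const
    (EuclideanSpace.single (Fin.last n) (1 : ℝ))).const_add (point x' 0)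

lemma contDiff_point {n : ℕ} (x' : EuclideanSpace ℝ (Fin n)) :
    ContDiff ℝ 1 fun y => point x' y := by
  have h : (fun y => point x' y)
      = fun y => point x' 0 + y • EuclideanSpace.single (Fin.last n) (1 : ℝ) :=
    funext fun y => point_eq_add_smul x' y
  rw [h]
  exact contDiff_const.add (contDiff_id.smul contDiff_const)

lemma measurePreserving_point (n : ℕ) :
    MeasurePreserving (fun z : EuclideanSpace ℝ (Fin n) × ℝ => point z.1 z.2) := by
  have h1 : MeasurePreserving (Prod.map (WithLp.ofLp (p := 2) (V := Fin n → ℝ)) (id : ℝ → ℝ))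
      ((volume : Measure (EuclideanSpace ℝ (Fin n))).prod volume) (volume.prod volume) :=
    (PiLp.volume_preserving_ofLp (Fin n)).prod (MeasurePreserving.id _)
  have h2 := (volume_preserving_piFinSuccAbove (fun _ : Fin (n + 1) => ℝ) (Fin.last n)).symm
  have h3 := PiLp.volume_preserving_toLp (Fin (n + 1))
  have h := h3.comp (h2.comp ((Measure.measurePreserving_swap
    (μ := (volume : Measure (Fin n → ℝ))) (ν := (volume : Measure ℝ))).comp h1))
  convert h using 1
  · funext z
    simp only [point, Function.comp, MeasurableEquiv.piFinSuccAbove_symm_apply]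
    simp
    rfl
  · exact Measure.volume_eq_prod _ _

lemma lintegral_eq_lintegral_sections {n : ℕ} {F : Space n → ℝ≥0∞} (hF : Measurable F) :
    ∫⁻ x, F x = ∫⁻ x' : EuclideanSpace ℝ (Fin n), ∫⁻ y : ℝ, F (point x' y) := by
  rw [← (measurePreserving_point n).lintegral_comp hF, Measure.volume_eq_prod,
    lintegral_prod (fun z : EuclideanSpace ℝ (Fin n) × ℝ => F (point z.1 z.2)) (hF.comp (measurePreserving_point n).measurable).aemeasurable]

/-- A weighted one-dimensional Poincaré inequality. -/
lemma lintegral_enorm_sq_le {g : ℝ → ℝ} (hg : ContDiff ℝ 1 g) (hc : HasCompactSupport g)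
    {T : Set ℝ} (hT : MeasurableSet T) {σ X : ℝ → ℝ≥0∞} (hσ : Measurable σ) (hX : Measurable X)
    (hg0 : ∀ y, y ∉ T → g y = 0) (hg0' : ∀ y, y ∉ T → deriv g y = 0)
    (hle : ∀ y ∈ T, ‖deriv g y‖ₑ ^ 2 ≤ σ y * X y) :
    ∫⁻ y, ‖g y‖ₑ ^ 2 ≤ volume T * ((∫⁻ y in T, σ y) * ∫⁻ y, X y) := by
  -- A uniform bound: `|g|` is at most the integral of `|g'|` over `T`, and Cauchy–Schwarz with
  -- `|g'| ≤ σ^(1/2) X^(1/2)` separates the weight from the energy. Integration over `T` then gives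
  -- the factor `volume T`.
  have hpt : ∀ y, ‖g y‖ₑ ^ 2 ≤ (∫⁻ y in T, σ y) * ∫⁻ y, X y := by
    intro y
    have h1 : ‖g y‖ₑ ≤ ∫⁻ y in T, ‖deriv g y‖ₑ := by
      refine (hc.enorm_le_lintegral_Ici_deriv hg y).trans ((setLIntegral_le_lintegral _ _).trans ?_)
      rw [← lintegral_indicator hT]
      refine lintegral_mono fun z => ?_
      by_cases hz : z ∈ T
      · rw [indicator_of_mem hz]
      · simp [hg0' z hz]
    have h2 : ∫⁻ y in T, ‖deriv g y‖ₑ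
        ≤ ∫⁻ y in T, ((fun y => σ y ^ (1 / 2 : ℝ)) * fun y => X y ^ (1 / 2 : ℝ)) y := by
      refine setLIntegral_mono' hT fun z hz => ?_
      rw [Pi.mul_apply, ← ENNReal.mul_rpow_of_nonneg _ _ (by norm_num),
        one_div, ENNReal.le_rpow_inv_iff two_pos]
      exact_mod_cast hle z hz
    have h3 := ENNReal.lintegral_mul_le_Lp_mul_Lq (volume.restrict T) Real.HolderConjugate.two_two
      (hσ.pow_const (1 / 2 : ℝ)).aemeasurable (hX.pow_const (1 / 2 : ℝ)).aemeasurable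
    have h4 := h1.trans (h2.trans h3)
    have e : ∀ t : ℝ≥0∞, (t ^ (1 / 2 : ℝ)) ^ (2 : ℝ) = t := fun t => by
      rw [← ENNReal.rpow_mul]; norm_num
    simp only [e] at h4
    rw [← ENNReal.mul_rpow_of_nonneg _ _ (by norm_num)] at h4
    have h5 := pow_le_pow_left' h4 2
    rw [← ENNReal.rpow_natCast (_ ^ _) 2] at h5
    push_cast at h5
    rw [e] at h5
    refine h5.trans ?_
    gcongr
    exact Measure.restrict_le_self
  calc ∫⁻ y, ‖g y‖ₑ ^ 2 = ∫⁻ y in T, ‖g y‖ₑ ^ 2 := by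
        rw [← lintegral_indicator hT]
        refine lintegral_congr fun z => ?_
        by_cases hz : z ∈ T
        · rw [indicator_of_mem hz]
        · simp [hz, hg0 z hz]
    _ ≤ ∫⁻ _ in T, (∫⁻ y in T, σ y) * ∫⁻ y, X y := lintegral_mono fun y => hpt y
    _ = _ := by rw [setLIntegral_const, mul_comm]

/-- The weighted energy density `(|∇u|+|∇v|)^(p-2) |∇u-∇v|^2 w^(2n) η^(2n+2)`. -/
def energyDensity {n : ℕ} (p : ℝ) (u v : Space n → ℝ) (S : Set (Space n)) (δ d : ℝ)
    (x : Space n) : ℝ :=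
  (‖∇ u x‖ + ‖∇ v x‖) ^ (p - 2) * ‖∇ u x - ∇ v x‖ ^ 2 *
    (truncDiff u v S δ x ^ (2 * n) * cutoff d x ^ (2 * n + 2))

lemma energyDensity_nonneg {n : ℕ} (p : ℝ) (u v : Space n → ℝ) (S : Set (Space n)) (δ d : ℝ)
    (x : Space n) : 0 ≤ energyDensity p u v S δ d x := by
  have h1 := truncDiff_nonneg u v S δ x
  have h2 := cutoff_nonneg d x
  unfold energyDensity
  positivity

lemma measurable_gradient {n : ℕ} (u : Space n → ℝ) : Measurable fun x => ∇ u x :=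
  (InnerProductSpace.toDual ℝ (Space n)).symm.continuous.measurable.comp (measurable_fderiv ℝ u)

section Poincare

variable {n : ℕ} {u v : Space n → ℝ} {S : Set (Space n)} {δ d lam y₀ : ℝ}

lemma measurable_truncDiff (hS : IsOpen S) (hu : ContinuousOn u S) (hv : ContinuousOn v S) :
    Measurable (truncDiff u v S δ) := by
  classical
  have h : ContinuousOn (fun x => max (u x - v x - δ) 0) S :=
    (continuous_id.max continuous_const).comp_continuousOn ((hu.sub hv).sub continuousOn_const)
  have := h.measurable_piecewise (continuousOn_const (c := (0 : ℝ)) (s := Sᶜ)) hS.measurableSet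
  rwa [show (fun _ : Space n => (0 : ℝ)) = 0 from rfl, piecewise_eq_indicator] at this

lemma measurable_energyDensity (p : ℝ) (hS : IsOpen S) (hu : ContinuousOn u S)
    (hv : ContinuousOn v S) : Measurable (energyDensity p u v S δ d) := by
  have h1 := measurable_truncDiff (δ := δ) hS hu hv
  have h2 := (continuous_cutoff (n := n) d).measurable
  have h3 := measurable_gradient u
  have h4 := measurable_gradient v
  unfold energyDensity
  fun_prop

lemma volume_section_le (hsub : S ⊆ strip n lam y₀) (x' : EuclideanSpace ℝ (Fin n)) :
    volume {y : ℝ | point x' y ∈ S} ≤ ENNReal.ofReal lam := by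
  have : {y : ℝ | point x' y ∈ S} ⊆ Ioo (y₀ - lam / 2) (y₀ + lam / 2) := fun y hy => by
    have : point x' y (Fin.last n) ∈ Ioo (y₀ - lam / 2) (y₀ + lam / 2) := hsub hy
    simpa using this
  refine (measure_mono this).trans ?_
  rw [Real.volume_Ioo]
  exact ENNReal.ofReal_le_ofReal (by linarith)

/-- The source of the smallness: since `2 - p > 0`, the inverse weight is at most `(2M)^(2-p)` on
`A`, of measure at most `τ`, and at most `(2ε)^(2-p)` on `B`, of measure at most `lam`. -/
lemma lintegral_section_rpow_le {p τ ε M : ℝ} (hp : p < 2) (hM : 0 ≤ M) (hτ : 0 ≤ τ) (hε : 0 ≤ ε)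
    (hlam : 0 ≤ lam) (hsub : S ⊆ strip n lam y₀) (hsplit : SectionsSplit τ ε u v S)
    (hMu : ∀ x ∈ S, ‖∇ u x‖ ≤ M) (hMv : ∀ x ∈ S, ‖∇ v x‖ ≤ M) (x' : EuclideanSpace ℝ (Fin n)) :
    ∫⁻ y in {y : ℝ | point x' y ∈ S},
        ENNReal.ofReal ((‖∇ u (point x' y)‖ + ‖∇ v (point x' y)‖) ^ (2 - p))
      ≤ ENNReal.ofReal (τ * (2 * M) ^ (2 - p) + lam * (2 * ε) ^ (2 - p)) := by
  obtain ⟨A, B, hA, hB, hAB, -, hAτ, hBε⟩ := hsplit x'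
  have hvB : volume B ≤ ENNReal.ofReal lam :=
    (measure_mono (hAB ▸ subset_union_right)).trans (volume_section_le hsub x')
  have hsetA : ∀ y ∈ A, point x' y ∈ S := fun y hy => by
    have : y ∈ A ∪ B := Or.inl hy
    rwa [← hAB] at this
  rw [hAB, ENNReal.ofReal_add (by positivity) (by positivity), ENNReal.ofReal_mul hτ,
    ENNReal.ofReal_mul hlam]
  refine (lintegral_union_le _ _ _).trans (add_le_add ?_ ?_)
  · calc _ ≤ ∫⁻ _ in A, ENNReal.ofReal ((2 * M) ^ (2 - p)) := by
          refine lintegral_mono_ae ((ae_restrict_iff'₀ hA).2 (Filter.Eventually.of_forall ?_))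
          intro y hy
          refine ENNReal.ofReal_le_ofReal (Real.rpow_le_rpow (by positivity) ?_ (by linarith))
          linarith [hMu _ (hsetA y hy), hMv _ (hsetA y hy)]
      _ = volume A * ENNReal.ofReal ((2 * M) ^ (2 - p)) := by rw [setLIntegral_const, mul_comm]
      _ ≤ _ := by gcongr
  · calc _ ≤ ∫⁻ _ in B, ENNReal.ofReal ((2 * ε) ^ (2 - p)) := by
          refine lintegral_mono_ae ((ae_restrict_iff'₀ hB).2 (Filter.Eventually.of_forall ?_))
          intro y hy
          refine ENNReal.ofReal_le_ofReal (Real.rpow_le_rpow (by positivity) ?_ (by linarith))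
          have := hBε hy
          linarith [this.1, this.2]
      _ = volume B * ENNReal.ofReal ((2 * ε) ^ (2 - p)) := by rw [setLIntegral_const, mul_comm]
      _ ≤ _ := by gcongr

/-- On the sections of `S` the truncated difference satisfies a Poincaré inequality whose constant
is small when `τ` and `ε` are small. -/
lemma lintegral_truncDiff_pow_le {p τ ε M : ℝ} (hn : 1 ≤ n) (hp : p < 2) (hM : 0 ≤ M)
    (hτ : 0 ≤ τ) (hε : 0 ≤ ε) (hlam : 0 ≤ lam)
    (hd : 0 < d) (hδ : 0 < δ) (hS : IsOpen S) (hsub : S ⊆ strip n lam y₀)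
    (hb : ∀ x ∈ frontier S, u x ≤ v x)
    (hu : ContinuousOn u (closure S)) (hv : ContinuousOn v (closure S))
    (hu' : ∀ x ∈ S, ContDiffAt ℝ 1 u x) (hv' : ∀ x ∈ S, ContDiffAt ℝ 1 v x)
    (hsplit : SectionsSplit τ ε u v S)
    (hMu : ∀ x ∈ S, ‖∇ u x‖ ≤ M) (hMv : ∀ x ∈ S, ‖∇ v x‖ ≤ M) :
    ∫⁻ x, ENNReal.ofReal ((truncDiff u v S δ x * cutoff d x) ^ (2 * n + 2)) ≤
      ENNReal.ofReal (lam * (n + 1) ^ 2 * (τ * (2 * M) ^ (2 - p) + lam * (2 * ε) ^ (2 - p))) *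
        ∫⁻ x, ENNReal.ofReal (energyDensity p u v S δ d x) := by
  have hmE := measurable_energyDensity (δ := δ) (d := d) p hS (hu.mono subset_closure)
    (hv.mono subset_closure)
  have hmw : Measurable fun x =>
      ENNReal.ofReal ((truncDiff u v S δ x * cutoff d x) ^ (2 * n + 2)) :=
    (((measurable_truncDiff hS (hu.mono subset_closure) (hv.mono subset_closure)).mul
      (continuous_cutoff d).measurable).pow_const _).ennreal_ofReal
  rw [lintegral_eq_lintegral_sections hmw, lintegral_eq_lintegral_sections hmE.ennreal_ofReal,
    ← lintegral_const_mul' _ _ ENNReal.ofReal_ne_top]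
  refine lintegral_mono fun x' => ?_
  -- This is `(wη)^(n+1)`: its square is the left integrand, and its vertical derivative carries the
  -- factor `w^n η^(n+1)` whose square appears in the energy density.
  set φ := truncTest u v S δ d n n with hφ
  have hφ1 : ContDiff ℝ 1 φ := contDiff_truncTest hd hδ hS hsub hb hu hv hu' hv' hn hn
  have hmp : Measurable fun y => point x' y := (contDiff_point x').continuous.measurable
  set T : Set ℝ := {y : ℝ | point x' y ∈ S} with hT
  have hTm : MeasurableSet T := hmp hS.measurableSet
  have hφ0 : ∀ x, x ∉ S → x ∉ tsupport φ := fun x hx h =>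
    hx (truncSupport_subset hδ hS hb (tsupport_truncTest_subset hd hsub hu hv n n h))
  have hder : ∀ y, deriv (fun y => φ (point x' y)) y
      = fderiv ℝ φ (point x' y) (EuclideanSpace.single (Fin.last n) 1) := fun y =>
    ((hφ1.differentiable one_ne_zero _).hasFDerivAt.comp_hasDerivAt y
      (hasDerivAt_point x' y)).deriv
  have hgc : HasCompactSupport fun y => φ (point x' y) := by
    refine HasCompactSupport.of_support_subset_isCompact
      (isCompact_Icc (a := y₀ - lam / 2) (b := y₀ + lam / 2)) fun y hy => ?_
    have hyS : point x' y ∈ S := by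
      by_contra h
      exact hy (image_eq_zero_of_notMem_tsupport (hφ0 _ h))
    have : point x' y (Fin.last n) ∈ Ioo (y₀ - lam / 2) (y₀ + lam / 2) := hsub hyS
    rw [point_last] at this
    exact Ioo_subset_Icc_self this
  have hmσ : Measurable fun y : ℝ =>
      ENNReal.ofReal ((‖∇ u (point x' y)‖ + ‖∇ v (point x' y)‖) ^ (2 - p)) := by
    have h3 := (measurable_gradient u).comp hmp
    have h4 := (measurable_gradient v).comp hmp
    exact ((h3.norm.add h4.norm).pow_const _).ennreal_ofReal
  have key := lintegral_enorm_sq_le (g := fun y => φ (point x' y))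
    (σ := fun y => ENNReal.ofReal ((‖∇ u (point x' y)‖ + ‖∇ v (point x' y)‖) ^ (2 - p)))
    (X := fun y => ENNReal.ofReal ((n + 1) ^ 2 * energyDensity p u v S δ d (point x' y)))
    (hφ1.comp (contDiff_point x')) hgc hTm hmσ
    (((hmE.comp hmp).const_mul _).ennreal_ofReal)
    (fun y hy => image_eq_zero_of_notMem_tsupport (hφ0 _ hy))
    (fun y hy => by
      rw [hder]
      have : fderiv ℝ φ (point x' y) = 0 := by
        by_contra h
        exact hφ0 _ hy (support_fderiv_subset ℝ h)
      rw [this]; rfl) ?_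
  · have e1 : ∀ x, ENNReal.ofReal ((truncDiff u v S δ x * cutoff d x) ^ (2 * n + 2))
        = ‖φ x‖ₑ ^ 2 := by
      intro x
      rw [Real.enorm_eq_ofReal (truncTest_nonneg u v S δ d n n x),
        ← ENNReal.ofReal_pow (truncTest_nonneg u v S δ d n n x)]
      congr 1
      rw [truncTest]; ring
    simp only [e1]
    refine key.trans ?_
    have e2 : ∫⁻ y, ENNReal.ofReal ((n + 1) ^ 2 * energyDensity p u v S δ d (point x' y))
        = ENNReal.ofReal ((n + 1) ^ 2) * ∫⁻ y, ENNReal.ofReal (energyDensity p u v S δ d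
          (point x' y)) := by
      rw [← lintegral_const_mul' _ _ ENNReal.ofReal_ne_top]
      exact lintegral_congr fun y => ENNReal.ofReal_mul (by positivity)
    rw [e2]
    calc _ ≤ ENNReal.ofReal lam * (ENNReal.ofReal (τ * (2 * M) ^ (2 - p) + lam * (2 * ε) ^ (2 - p))
          * (ENNReal.ofReal ((n + 1) ^ 2) * ∫⁻ y, ENNReal.ofReal (energyDensity p u v S δ d
          (point x' y)))) := by
          gcongr
          · exact volume_section_le hsub x'
          · exact lintegral_section_rpow_le hp hM hτ hε hlam hsub hsplit hMu hMv x'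
      _ = _ := by
          rw [ENNReal.ofReal_mul (by positivity), ENNReal.ofReal_mul hlam]; ring
  · intro y hy
    set x := point x' y
    have hxS : x ∈ S := hy
    rw [hder, hφ, fderiv_truncTest hS hxS ((hu' x hxS).differentiableAt one_ne_zero)
      ((hv' x hxS).differentiableAt one_ne_zero) hn hn, add_apply,
      smul_apply, smul_apply, horizDeriv_single_last, smul_zero, add_zero,
      Real.enorm_eq_ofReal_abs, ← ENNReal.ofReal_pow (abs_nonneg _),
      ← ENNReal.ofReal_mul (by positivity), sq_abs]
    refine ENNReal.ofReal_le_ofReal ?_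
    set s := ‖∇ u x‖ + ‖∇ v x‖ with hs
    set w := truncDiff u v S δ x
    set η := cutoff d x
    have hD : |(fderiv ℝ u x - fderiv ℝ v x) (EuclideanSpace.single (Fin.last n) 1)|
        ≤ ‖∇ u x - ∇ v x‖ := by
      rw [norm_gradient_sub_gradient]
      simpa using (fderiv ℝ u x - fderiv ℝ v x).le_opNorm (EuclideanSpace.single (Fin.last n) 1)
    -- The weights cancel even at `s = 0`, where the gradient difference vanishes too.
    have hsw : s ^ (2 - p) * (s ^ (p - 2) * ‖∇ u x - ∇ v x‖ ^ 2) = ‖∇ u x - ∇ v x‖ ^ 2 := by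
      have hs0 : 0 ≤ s := by positivity
      rcases eq_or_lt_of_le hs0 with h | h
      · have : ‖∇ u x - ∇ v x‖ = 0 :=
          le_antisymm ((norm_sub_le _ _).trans h.ge) (norm_nonneg _)
        simp [this]
      · rw [← mul_assoc, ← Real.rpow_add h]; simp
    have e : s ^ (2 - p) * ((n + 1) ^ 2 * energyDensity p u v S δ d x)
        = ((n + 1) * w ^ n * η ^ (n + 1)) ^ 2 *
          (s ^ (2 - p) * (s ^ (p - 2) * ‖∇ u x - ∇ v x‖ ^ 2)) := by
      rw [energyDensity]; ring
    rw [e, hsw, smul_eq_mul, mul_pow]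
    refine mul_le_mul_of_nonneg_left ?_ (sq_nonneg _)
    rw [← sq_abs]
    gcongr

end Poincare

/-! ### Pointwise bounds and the weak formulation with `C¹` tests -/

/-- By continuity the set where the bound fails is open; being null, it is empty. -/
lemma norm_le_of_supNorm_le {n : ℕ} {F : Type*} [NormedAddCommGroup F] {Ω : Set (Space n)}
    (hΩ : IsOpen Ω) {g : Space n → F} (hg : ContinuousOn g Ω) {M : ℝ} (hM : 0 ≤ M)
    (h : supNorm Ω g ≤ ENNReal.ofReal M) : ∀ x ∈ Ω, ‖g x‖ ≤ M := by
  have hae : ∀ᵐ x ∂(volume.restrict Ω), ‖g x‖ ≤ M := by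
    have h1 : ∀ᵐ x ∂(volume.restrict Ω), ‖g x‖ₑ ≤ eLpNormEssSup g (volume.restrict Ω) :=
      ae_le_eLpNormEssSup
    filter_upwards [h1] with x hx
    rw [supNorm, eLpNorm_exponent_top] at h
    have h2 := hx.trans h
    rw [← ofReal_norm] at h2
    exact (ENNReal.ofReal_le_ofReal_iff hM).1 h2
  have hopen : IsOpen (Ω ∩ (fun x => ‖g x‖) ⁻¹' Ioi M) :=
    hg.norm.isOpen_inter_preimage hΩ isOpen_Ioi
  rw [ae_restrict_iff' hΩ.measurableSet, ae_iff] at hae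
  have hz : volume (Ω ∩ (fun x => ‖g x‖) ⁻¹' Ioi M) = 0 := by
    refine measure_mono_null (fun x hx => ?_) hae
    rintro h'
    exact absurd (h' hx.1) (not_le.2 hx.2)
  have he := hopen.measure_eq_zero_iff volume |>.1 hz
  intro x hx
  by_contra hlt
  have : x ∈ Ω ∩ (fun x => ‖g x‖) ⁻¹' Ioi M := ⟨hx, not_le.1 hlt⟩
  rw [he] at this
  exact this

lemma strip_subset_halfSpace {n : ℕ} {lam y₀ : ℝ} (h : lam / 2 ≤ y₀) :
    strip n lam y₀ ⊆ halfSpace n := by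
  intro x hx
  have : x (Fin.last n) ∈ Ioo (y₀ - lam / 2) (y₀ + lam / 2) := hx
  change 0 < x (Fin.last n)
  linarith [this.1]

section WeakForm

variable {n : ℕ} {p q : ℝ} {a b f : Space n → ℝ → ℝ} {Ω : Set (Space n)} {u : Space n → ℝ}

lemma ContinuousCoeff.comp_continuousOn {g : Space n → ℝ → ℝ} (hg : ContinuousCoeff g)
    (hΩ : Ω ⊆ halfSpace n) (hu : ContinuousOn u Ω) : ContinuousOn (fun x => g x (u x)) Ω :=
  ContinuousOn.comp (g := fun z : Space n × ℝ => g z.1 z.2) (f := fun x => (x, u x)) hg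
    (continuousOn_id.prodMk hu) fun _ hx => ⟨hΩ hx, mem_univ _⟩

/-- The flux `a(x,u) |∇u|^(p-2) ∇u`. -/
def fluxField (p : ℝ) (a : Space n → ℝ → ℝ) (u : Space n → ℝ) (x : Space n) : Space n :=
  a x (u x) • ((‖∇ u x‖ ^ (p - 2)) • ∇ u x)

/-- The zero-order part `b(x,u) |∇u|^q - f(x,u)`. -/
def lowerOrder (q : ℝ) (b f : Space n → ℝ → ℝ) (u : Space n → ℝ) (x : Space n) : ℝ :=
  b x (u x) * ‖∇ u x‖ ^ q - f x (u x)

lemma continuousOn_fluxField (hp : 1 < p) (ha : ContinuousCoeff a) (hΩ : Ω ⊆ halfSpace n)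
    (hu : ContinuousOn u Ω) (hu' : ContinuousOn (fun x => ∇ u x) Ω) :
    ContinuousOn (fluxField p a u) Ω :=
  (ha.comp_continuousOn hΩ hu).smul ((continuous_flux hp).comp_continuousOn hu')

lemma continuousOn_mul_gradient_rpow (hq : 1 < q) (hb : ContinuousCoeff b) (hΩ : Ω ⊆ halfSpace n)
    (hu : ContinuousOn u Ω) (hu' : ContinuousOn (fun x => ∇ u x) Ω) :
    ContinuousOn (fun x => b x (u x) * ‖∇ u x‖ ^ q) Ω :=
  (hb.comp_continuousOn hΩ hu).mul
    (hu'.norm.rpow_const fun _ _ => Or.inr (by linarith))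

lemma continuousOn_lowerOrder (hq : 1 < q) (hb : ContinuousCoeff b) (hf : ContinuousCoeff f)
    (hΩ : Ω ⊆ halfSpace n) (hu : ContinuousOn u Ω) (hu' : ContinuousOn (fun x => ∇ u x) Ω) :
    ContinuousOn (lowerOrder q b f u) Ω :=
  (continuousOn_mul_gradient_rpow hq hb hΩ hu hu').sub (hf.comp_continuousOn hΩ hu)

lemma setIntegral_divForm_fluxField (hp : 1 < p) (hq : 1 < q) (ha : ContinuousCoeff a)
    (hb : ContinuousCoeff b) (hf : ContinuousCoeff f) (hΩ : Ω ⊆ halfSpace n)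
    (hu : ContinuousOn u Ω) (hu' : ContinuousOn (fun x => ∇ u x) Ω) {φ : Space n → ℝ}
    (hφ : IsNonnegTest Ω φ) :
    ∫ x in Ω, divForm (fluxField p a u) (lowerOrder q b f u) φ x
      = (∫ x in Ω, weakLHS p q a b u φ x) - ∫ x in Ω, f x (u x) * φ x := by
  have hφ1 : ContDiff ℝ 1 φ := hφ.1.of_le (by norm_cast)
  have e1 : weakLHS p q a b u φ
      = divForm (fluxField p a u) (fun x => b x (u x) * ‖∇ u x‖ ^ q) φ := by
    funext x
    rw [weakLHS, divForm, fluxField, real_inner_smul_left _ _ (a x (u x))]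
  have e2 : (fun x => f x (u x) * φ x) = divForm (fun _ => 0) (fun x => f x (u x)) φ := by
    funext x
    rw [divForm, inner_zero_left, zero_add]
  have i1 := integrable_divForm (continuousOn_fluxField hp ha hΩ hu hu')
    (continuousOn_mul_gradient_rpow hq hb hΩ hu hu') hφ1 hφ.2.1 hφ.2.2.1
  have i2 := integrable_divForm (F := fun _ => 0) continuousOn_const (hf.comp_continuousOn hΩ hu)
    hφ1 hφ.2.1 hφ.2.2.1
  rw [e1, e2, ← integral_sub i1.integrableOn i2.integrableOn]
  refine integral_congr_ae (Filter.Eventually.of_forall fun x => ?_)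
  simp only [divForm, lowerOrder, inner_zero_left]
  ring

lemma IsWeakSubsolution.integral_divForm_nonpos (hp : 1 < p) (hq : 1 < q) (ha : ContinuousCoeff a)
    (hb : ContinuousCoeff b) (hf : ContinuousCoeff f) (hΩo : IsOpen Ω) (hΩ : Ω ⊆ halfSpace n)
    (hu : ContinuousOn u Ω) (hu' : ContinuousOn (fun x => ∇ u x) Ω)
    (hsub : IsWeakSubsolution p q a b f Ω u) {φ : Space n → ℝ} (hφ : ContDiff ℝ 1 φ)
    (hc : HasCompactSupport φ) (hs : tsupport φ ⊆ Ω) (h0 : ∀ x, 0 ≤ φ x) :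
    ∫ x, divForm (fluxField p a u) (lowerOrder q b f u) φ x ≤ 0 := by
  rw [← setIntegral_eq_integral_of_forall_compl_eq_zero (s := Ω)
    fun x hx => divForm_eq_zero fun h => hx (hs h)]
  refine setIntegral_divForm_nonpos hΩo (continuousOn_fluxField hp ha hΩ hu hu')
    (continuousOn_lowerOrder hq hb hf hΩ hu hu') (fun ψ hψ => ?_) hφ hc hs h0
  rw [setIntegral_divForm_fluxField hp hq ha hb hf hΩ hu hu' hψ]
  linarith [hsub ψ hψ]

lemma IsWeakSupersolution.integral_divForm_nonneg (hp : 1 < p) (hq : 1 < q)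
    (ha : ContinuousCoeff a) (hb : ContinuousCoeff b) (hf : ContinuousCoeff f) (hΩo : IsOpen Ω)
    (hΩ : Ω ⊆ halfSpace n) (hu : ContinuousOn u Ω) (hu' : ContinuousOn (fun x => ∇ u x) Ω)
    (hsup : IsWeakSupersolution p q a b f Ω u) {φ : Space n → ℝ} (hφ : ContDiff ℝ 1 φ)
    (hc : HasCompactSupport φ) (hs : tsupport φ ⊆ Ω) (h0 : ∀ x, 0 ≤ φ x) :
    0 ≤ ∫ x, divForm (fluxField p a u) (lowerOrder q b f u) φ x := by
  rw [← setIntegral_eq_integral_of_forall_compl_eq_zero (s := Ω)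
    fun x hx => divForm_eq_zero fun h => hx (hs h)]
  -- Changing the sign of both coefficients turns the supersolution inequality into the subsolution
  -- one.
  have hneg : ∀ ψ : Space n → ℝ, ∫ x in Ω, divForm (-fluxField p a u)
      (-lowerOrder q b f u) ψ x = -∫ x in Ω, divForm (fluxField p a u) (lowerOrder q b f u) ψ x :=
      fun ψ => by
    rw [← integral_neg]
    refine integral_congr_ae (Filter.Eventually.of_forall fun x => ?_)
    simp only [divForm, Pi.neg_apply, inner_neg_left]
    ring
  have := setIntegral_divForm_nonpos hΩo (continuousOn_fluxField hp ha hΩ hu hu').neg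
    (continuousOn_lowerOrder hq hb hf hΩ hu hu').neg (fun ψ hψ => ?_) hφ hc hs h0
  · have h2 := hneg φ
    linarith
  · have h1 := hneg ψ
    rw [setIntegral_divForm_fluxField hp hq ha hb hf hΩ hu hu' hψ] at h1
    linarith [hsup ψ hψ]

end WeakForm

/-! ### Volume of the support -/

section Volume

variable {n : ℕ} {u v : Space n → ℝ} {S : Set (Space n)} {δ d lam y₀ : ℝ}

/-- The support lies in the box of horizontal half-width `1 / d` over the closed slab. The resulting
growth `d^(-n)` is what the error `d^(2n+2)` has to beat. -/
lemma volume_truncSupport_le (hd : 0 < d) (hsub : S ⊆ strip n lam y₀) :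
    volume (truncSupport u v S δ d) ≤ ENNReal.ofReal ((2 / d) ^ n * lam) := by
  set lo : Fin (n + 1) → ℝ := Fin.snoc (α := fun _ => ℝ) (fun _ : Fin n => -(1 / d)) (y₀ - lam / 2)
  set hi : Fin (n + 1) → ℝ := Fin.snoc (α := fun _ => ℝ) (fun _ : Fin n => 1 / d) (y₀ + lam / 2)
  have hsubset : truncSupport u v S δ d ⊆ WithLp.ofLp ⁻¹' Icc lo hi := by
    rintro x ⟨hx, -, hx2⟩
    have hy := closure_subset_slab hsub hx
    have hi' : ∀ i : Fin n, |x i.castSucc| ≤ 1 / d := by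
      intro i
      have h1 : x i.castSucc ^ 2 ≤ horizSq x :=
        Finset.single_le_sum (f := fun i : Fin n => x i.castSucc ^ 2)
          (fun _ _ => sq_nonneg _) (Finset.mem_univ i)
      refine abs_le_of_sq_le_sq ?_ (by positivity)
      rw [one_div, inv_pow, ← one_div, le_div_iff₀ (by positivity)]
      nlinarith [sq_nonneg d]
    refine ⟨fun i => ?_, fun i => ?_⟩
    · refine Fin.lastCases ?_ (fun i => ?_) i
      · simpa [lo] using hy.1
      · simpa [lo] using (abs_le.1 (hi' i)).1
    · refine Fin.lastCases ?_ (fun i => ?_) i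
      · simpa [hi] using hy.2
      · simpa [hi] using (abs_le.1 (hi' i)).2
  refine (measure_mono hsubset).trans ?_
  rw [(PiLp.volume_preserving_ofLp (Fin (n + 1))).measure_preimage
    measurableSet_Icc.nullMeasurableSet, Real.volume_Icc_pi, Fin.prod_univ_castSucc]
  simp only [lo, hi, Fin.snoc_castSucc, Fin.snoc_last, Finset.prod_const, Finset.card_univ,
    Fintype.card_fin]
  rw [← ENNReal.ofReal_pow (by have : 0 ≤ 1 / d := by positivity
                               linarith), ← ENNReal.ofReal_mul (by
    have : 0 ≤ 1 / d := by positivity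
    exact pow_nonneg (by linarith) _)]
  refine ENNReal.ofReal_le_ofReal (le_of_eq ?_)
  rw [show 1 / d - -(1 / d) = 2 / d by ring, show y₀ + lam / 2 - (y₀ - lam / 2) = lam by ring]

end Volume

/-! ### Energy estimate and lower bound for the truncated integrals -/

section Comparison

variable {n : ℕ} {u v : Space n → ℝ} {S : Set (Space n)} {δ d lam y₀ : ℝ}

lemma gradient_truncTest (hS : IsOpen S) {x : Space n} (hx : x ∈ S)
    (hu : DifferentiableAt ℝ u x) (hv : DifferentiableAt ℝ v x)
    {i j : ℕ} (hi : 1 ≤ i) (hj : 1 ≤ j) :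
    ∇ (truncTest u v S δ d i j) x =
      ((i + 1) * truncDiff u v S δ x ^ i * cutoff d x ^ (j + 1)) • (∇ u x - ∇ v x)
      + ((j + 1) * truncDiff u v S δ x ^ (i + 1) * cutoff d x ^ j) •
        (InnerProductSpace.toDual ℝ (Space n)).symm (horizDeriv d x) := by
  simp only [gradient]
  rw [fderiv_truncTest hS hx hu hv hi hj]
  simp

lemma integrable_truncTest (hd : 0 < d) (hδ : 0 < δ) (hS : IsOpen S)
    (hsub : S ⊆ strip n lam y₀) (hb : ∀ x ∈ frontier S, u x ≤ v x)
    (hu : ContinuousOn u (closure S)) (hv : ContinuousOn v (closure S))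
    (hu' : ∀ x ∈ S, ContDiffAt ℝ 1 u x) (hv' : ∀ x ∈ S, ContDiffAt ℝ 1 v x)
    {i j : ℕ} (hi : 1 ≤ i) (hj : 1 ≤ j) : Integrable (truncTest u v S δ d i j) :=
  (contDiff_truncTest hd hδ hS hsub hb hu hv hu' hv' hi hj).continuous.integrable_of_hasCompactSupport
    ((isCompact_truncSupport hd hsub hu hv).of_isClosed_subset (isClosed_tsupport _)
      (tsupport_truncTest_subset hd hsub hu hv i j))

lemma truncDiff_mul_cutoff_pow (i : ℕ) (x : Space n) :
    (truncDiff u v S δ x * cutoff d x) ^ (i + 1) = truncTest u v S δ d i i x :=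
  mul_pow _ _ _

lemma integrable_energyDensity {p M : ℝ} (hn : 1 ≤ n) (hp : 1 < p)
    (hd : 0 < d) (hδ : 0 < δ) (hS : IsOpen S)
    (hsub : S ⊆ strip n lam y₀) (hb : ∀ x ∈ frontier S, u x ≤ v x)
    (hu : ContinuousOn u (closure S)) (hv : ContinuousOn v (closure S))
    (hu' : ∀ x ∈ S, ContDiffAt ℝ 1 u x) (hv' : ∀ x ∈ S, ContDiffAt ℝ 1 v x)
    (hMu : ∀ x ∈ S, ‖∇ u x‖ ≤ M) (hMv : ∀ x ∈ S, ‖∇ v x‖ ≤ M) :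
    Integrable (energyDensity p u v S δ d) := by
  -- `truncTest` raises both exponents by one, so these indices give the majorant `(2M)^p w^(2n)
  -- η^(2n+2)`.
  refine ((integrable_truncTest hd hδ hS hsub hb hu hv hu' hv' (i := 2 * n - 1) (j := 2 * n + 1)
    (by omega) (by omega)).const_mul ((2 * M) ^ p)).mono'
    (measurable_energyDensity p hS (hu.mono subset_closure)
      (hv.mono subset_closure)).aestronglyMeasurable (Filter.Eventually.of_forall fun x => ?_)
  rw [Real.norm_of_nonneg (energyDensity_nonneg p u v S δ d x), energyDensity, truncTest,
    show 2 * n - 1 + 1 = 2 * n by omega, show 2 * n + 1 + 1 = 2 * n + 2 by omega]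
  by_cases hx : x ∈ S
  · refine mul_le_mul_of_nonneg_right ?_ (mul_nonneg (pow_nonneg (truncDiff_nonneg u v S δ x) _)
      (pow_nonneg (cutoff_nonneg d x) _))
    refine (rpow_sub_two_mul_norm_sub_sq_le hp _ _).trans
      (Real.rpow_le_rpow (by positivity) ?_ (by linarith))
    linarith [hMu x hx, hMv x hx]
  · rw [truncDiff, indicator_of_notMem hx, zero_pow (by omega)]
    simp

/-- The Caccioppoli-type energy estimate obtained by testing the difference of the two
inequalities with `w^(2n+1) η^(2n+2)`. -/
lemma exists_energy_estimate (n : ℕ) (hn : 1 ≤ n) {p q γ M La Lb Lf K : ℝ} (hp1 : 1 < p)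
    (hp2 : p < 2) (hq1 : 1 < q) (hγ : 0 < γ) (hM : 0 < M) (hLa : 0 < La) (hLb : 0 < Lb)
    (hLf : 0 < Lf) (hK : 0 < K) :
    ∃ c C : ℝ, 0 < c ∧ 0 < C ∧
      ∀ (a b f : Space n → ℝ → ℝ) (I : Set ℝ) (u v : Space n → ℝ) (S : Set (Space n))
        (lam y₀ d : ℝ), AdmissibleCoeffs γ a b f → CoeffBounds I a b f La Lb Lf K →
        lam / 2 ≤ y₀ → 0 < lam → 0 < d → d ≤ 1 →
        IsOpen S → S ⊆ strip n lam y₀ → (∀ x ∈ frontier S, u x ≤ v x) →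
        ContinuousOn u (closure (strip n lam y₀)) → ContinuousOn v (closure (strip n lam y₀)) →
        (∀ x ∈ strip n lam y₀, ContDiffAt ℝ 1 u x) →
        (∀ x ∈ strip n lam y₀, ContDiffAt ℝ 1 v x) →
        ContinuousOn (fun x => ∇ u x) (strip n lam y₀) →
        ContinuousOn (fun x => ∇ v x) (strip n lam y₀) →
        (∀ x ∈ S, ‖∇ u x‖ ≤ M) → (∀ x ∈ S, ‖∇ v x‖ ≤ M) →
        (∀ x ∈ S, u x ∈ I) → (∀ x ∈ S, v x ∈ I) →
        IsWeakSubsolution p q a b f (strip n lam y₀) u →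
        IsWeakSupersolution p q a b f (strip n lam y₀) v →
        c * ∫ x, energyDensity p u v S (d ^ 2) d x ≤
          C * ((∫ x, truncTest u v S (d ^ 2) d (2 * n + 1) (2 * n + 1) x)
            + d ^ (2 * n + 2) * ((2 / d) ^ n * lam)) := by
  obtain ⟨c, C, hc, hC, hpt⟩ := exists_pointwise_lower_bound n hp1 hp2 hq1 hγ hM hLa hLb hLf hK
  refine ⟨c, C, hc, hC, ?_⟩
  intro a b f I u v S lam y₀ d hadm hI hy hlam hd hd1 hS hsub hb hu hv hu1 hv1 hu' hv' hMu hMv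
    hIu hIv hsubsol hsupsol
  have hhalf : strip n lam y₀ ⊆ halfSpace n := strip_subset_halfSpace hy
  have hδ : 0 < d ^ 2 := by positivity
  have huS : ContinuousOn u (closure S) := hu.mono (closure_mono hsub)
  have hvS : ContinuousOn v (closure S) := hv.mono (closure_mono hsub)
  have hu1S : ∀ x ∈ S, ContDiffAt ℝ 1 u x := fun x hx => hu1 x (hsub hx)
  have hv1S : ∀ x ∈ S, ContDiffAt ℝ 1 v x := fun x hx => hv1 x (hsub hx)
  have huΩ := hu.mono subset_closure
  have hvΩ := hv.mono subset_closure
  have hi : 1 ≤ 2 * n := by omega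
  have hj : 1 ≤ 2 * n + 1 := by omega
  -- With the shift of indices this is `w^(2n+1) η^(2n+2)`.
  set φ := truncTest u v S (d ^ 2) d (2 * n) (2 * n + 1) with hφ
  set κ := truncSupport u v S (d ^ 2) d with hκ
  have hκc : IsCompact κ := isCompact_truncSupport hd hsub huS hvS
  have hφ1 : ContDiff ℝ 1 φ := contDiff_truncTest hd hδ hS hsub hb huS hvS hu1S hv1S hi hj
  have hφκ : tsupport φ ⊆ κ := tsupport_truncTest_subset hd hsub huS hvS _ _
  have hφc : HasCompactSupport φ := hκc.of_isClosed_subset (isClosed_tsupport _) hφκ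
  have hκS : κ ⊆ S := truncSupport_subset hδ hS hb
  have hφs : tsupport φ ⊆ strip n lam y₀ := hφκ.trans (hκS.trans hsub)
  have hφ0 : ∀ x, 0 ≤ φ x := truncTest_nonneg u v S (d ^ 2) d _ _
  have hint_u := hsubsol.integral_divForm_nonpos hp1 hq1 hadm.cont_a hadm.cont_b hadm.cont_f
    (isOpen_strip _ _) hhalf huΩ hu' hφ1 hφc hφs hφ0
  have hint_v := hsupsol.integral_divForm_nonneg hp1 hq1 hadm.cont_a hadm.cont_b hadm.cont_f
    (isOpen_strip _ _) hhalf hvΩ hv' hφ1 hφc hφs hφ0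
  have i_u := integrable_divForm (continuousOn_fluxField hp1 hadm.cont_a hhalf huΩ hu')
    (continuousOn_lowerOrder hq1 hadm.cont_b hadm.cont_f hhalf huΩ hu') hφ1 hφc hφs
  have i_v := integrable_divForm (continuousOn_fluxField hp1 hadm.cont_a hhalf hvΩ hv')
    (continuousOn_lowerOrder hq1 hadm.cont_b hadm.cont_f hhalf hvΩ hv') hφ1 hφc hφs
  have i_E : Integrable (energyDensity p u v S (d ^ 2) d) :=
    integrable_energyDensity hn hp1 hd hδ hS hsub hb huS hvS hu1S hv1S hMu hMv
  have i_T : Integrable (truncTest u v S (d ^ 2) d (2 * n + 1) (2 * n + 1)) :=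
    integrable_truncTest hd hδ hS hsub hb huS hvS hu1S hv1S hj hj
  have i_κ : Integrable (κ.indicator fun _ => d ^ (2 * n + 2)) :=
    (integrable_indicator_iff hκc.measurableSet).2 (continuousOn_const.integrableOn_compact hκc)
  have i_Tκ : Integrable fun x => truncTest u v S (d ^ 2) d (2 * n + 1) (2 * n + 1) x
      + κ.indicator (fun _ => d ^ (2 * n + 2)) x := i_T.add i_κ
  have hpoint : ∀ x, c * energyDensity p u v S (d ^ 2) d x
      - C * (truncTest u v S (d ^ 2) d (2 * n + 1) (2 * n + 1) x
        + κ.indicator (fun _ => d ^ (2 * n + 2)) x)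
      ≤ divForm (fluxField p a u) (lowerOrder q b f u) φ x
        - divForm (fluxField p a v) (lowerOrder q b f v) φ x := by
    intro x
    have hκ0 : 0 ≤ κ.indicator (fun _ => d ^ (2 * n + 2)) x :=
      indicator_nonneg (fun _ _ => by positivity) x
    by_cases hx : x ∈ S
    · have hgrad := gradient_truncTest (δ := d ^ 2) (d := d) hS hx
        ((hu1S x hx).differentiableAt one_ne_zero) ((hv1S x hx).differentiableAt one_ne_zero)
        hi hj
      rw [← hφ] at hgrad
      push_cast at hgrad
      -- Where a factor vanishes, the test function, its gradient and the energy density all vanish.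
      -- Elsewhere `u - v = w + d²` exactly and `d |x'| ≤ 1`, as the pointwise inequality requires.
      by_cases hzero : truncDiff u v S (d ^ 2) x = 0 ∨ cutoff d x = 0
      · have hg0 : ∇ φ x = 0 := by
          rw [hgrad]
          rcases hzero with h | h <;> rw [h] <;> simp [show n ≠ 0 by omega]
        have hφx : φ x = 0 := by
          rw [hφ, truncTest]
          rcases hzero with h | h <;> rw [h] <;> simp
        have hE : energyDensity p u v S (d ^ 2) d x = 0 := by
          rw [energyDensity]
          rcases hzero with h | h <;> rw [h] <;> simp [show n ≠ 0 by omega]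
        rw [hE, divForm, divForm, hg0, hφx, inner_zero_right, inner_zero_right]
        have := truncTest_nonneg u v S (d ^ 2) d (2 * n + 1) (2 * n + 1) x
        have : 0 ≤ C * (truncTest u v S (d ^ 2) d (2 * n + 1) (2 * n + 1) x
            + κ.indicator (fun _ => d ^ (2 * n + 2)) x) := by positivity
        linarith
      · push Not at hzero
        have hxκ : x ∈ κ := (mem_truncSupport_of_ne_zero hzero.1 hzero.2).2
        have hw : truncDiff u v S (d ^ 2) x = u x - v x - d ^ 2 := by
          rw [truncDiff, indicator_of_mem hx]
          exact max_eq_left (by linarith [hxκ.2.1])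
        have hw0 := truncDiff_nonneg u v S (d ^ 2) x
        have huv : |u x - v x| = truncDiff u v S (d ^ 2) x + d ^ 2 := by
          rw [abs_of_nonneg (by linarith), hw]; ring
        have hxh := hhalf (hsub hx)
        have hIux := hIu x hx
        have hIvx := hIv x hx
        have h := hpt (Space n) (∇ u x) (∇ v x)
          ((InnerProductSpace.toDual ℝ (Space n)).symm (horizDeriv d x))
          (a x (u x)) (a x (v x)) (b x (u x)) (b x (v x)) (f x (u x)) (f x (v x))
          (truncDiff u v S (d ^ 2) x) (cutoff d x) d (hMu x hx) (hMv x hx)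
          (by rw [LinearIsometryEquiv.norm_map]; exact norm_horizDeriv_le hd.le hxκ.2.2)
          hw0 (cutoff_nonneg d x) (cutoff_le_one d x) hd.le hd1
          (hadm.ellipticity x hxh _) (hI.bound_a x hxh _ hIux) (hI.bound_a x hxh _ hIvx)
          (hI.bound_b x hxh _ hIux) (huv ▸ hI.lip_a x hxh _ hIux _ hIvx)
          (huv ▸ hI.lip_b x hxh _ hIux _ hIvx) (huv ▸ hI.lip_f x hxh _ hIux _ hIvx)
        rw [indicator_of_mem hxκ, ← truncDiff_mul_cutoff_pow]
        refine h.trans_eq ?_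
        rw [divForm, divForm, hgrad, fluxField, fluxField, real_inner_smul_left _ _ (a x (u x)),
          real_inner_smul_left _ _ (a x (v x)), lowerOrder, lowerOrder, hφ, truncTest]
        simp only [show (2 * (n : ℝ) + 1 + 1) = 2 * n + 2 by ring,
          show 2 * n + 1 + 1 = 2 * n + 2 by omega]
    · have hxt : x ∉ tsupport φ := fun h => hx (hκS (hφκ h))
      have hwx : truncDiff u v S (d ^ 2) x = 0 := indicator_of_notMem hx _
      rw [divForm_eq_zero hxt, divForm_eq_zero hxt, indicator_of_notMem (fun h => hx (hκS h)),
        energyDensity, truncTest, hwx, zero_pow (by omega : 2 * n ≠ 0),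
        zero_pow (by omega : 2 * n + 1 + 1 ≠ 0)]
      simp
  have hmono := integral_mono ((i_E.const_mul c).sub (i_Tκ.const_mul C))
    (i_u.sub i_v) hpoint
  have e1 : ∫ x, (c * energyDensity p u v S (d ^ 2) d x
      - C * (truncTest u v S (d ^ 2) d (2 * n + 1) (2 * n + 1) x
        + κ.indicator (fun _ => d ^ (2 * n + 2)) x))
      = c * (∫ x, energyDensity p u v S (d ^ 2) d x)
        - C * ((∫ x, truncTest u v S (d ^ 2) d (2 * n + 1) (2 * n + 1) x)
          + volume.real κ * d ^ (2 * n + 2)) := by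
    rw [integral_sub (i_E.const_mul c) (i_Tκ.const_mul C), integral_const_mul,
      integral_const_mul, integral_add i_T i_κ, integral_indicator_const _ hκc.measurableSet,
      smul_eq_mul]
  have e2 : ∫ x, (divForm (fluxField p a u) (lowerOrder q b f u) φ x
        - divForm (fluxField p a v) (lowerOrder q b f v) φ x)
      = (∫ x, divForm (fluxField p a u) (lowerOrder q b f u) φ x)
        - ∫ x, divForm (fluxField p a v) (lowerOrder q b f v) φ x := integral_sub i_u i_v
  have hvol : volume.real κ ≤ (2 / d) ^ n * lam :=
    ENNReal.toReal_le_of_le_ofReal (by positivity) (volume_truncSupport_le hd hsub)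
  have hmono' := (e1.symm.trans_le hmono).trans_eq e2
  have hlast : C * ((∫ x, truncTest u v S (d ^ 2) d (2 * n + 1) (2 * n + 1) x)
      + volume.real κ * d ^ (2 * n + 2)) ≤ C * ((∫ x, truncTest u v S (d ^ 2) d (2 * n + 1)
        (2 * n + 1) x) + d ^ (2 * n + 2) * ((2 / d) ^ n * lam)) := by
    rw [mul_comm (volume.real κ)]
    gcongr
  linarith

/-- If `u > v` somewhere in `S`, the integrals of the truncated differences stay away from zero. -/
lemma exists_lower_bound_integral (hS : IsOpen S) (hsub : S ⊆ strip n lam y₀)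
    (hb : ∀ x ∈ frontier S, u x ≤ v x)
    (hu : ContinuousOn u (closure S)) (hv : ContinuousOn v (closure S))
    (hu' : ∀ x ∈ S, ContDiffAt ℝ 1 u x) (hv' : ∀ x ∈ S, ContDiffAt ℝ 1 v x)
    {x₀ : Space n} (hx₀ : x₀ ∈ S) (h : v x₀ < u x₀) {i : ℕ} (hi : 1 ≤ i) :
    ∃ c₀ d₀ : ℝ, 0 < c₀ ∧ 0 < d₀ ∧ ∀ d, 0 < d → d ≤ d₀ →
      c₀ ≤ ∫ x, truncTest u v S (d ^ 2) d i i x := by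
  set k := u x₀ - v x₀ with hk
  have hk0 : 0 < k := sub_pos.2 h
  have hcont : ContinuousAt (fun x => u x - v x) x₀ :=
    (hu' x₀ hx₀).continuousAt.sub (hv' x₀ hx₀).continuousAt
  have hev : ∀ᶠ x in nhds x₀, x ∈ S ∧ k / 2 < u x - v x :=
    (hS.eventually_mem hx₀).and (hcont.eventually (lt_mem_nhds (by change k / 2 < k; linarith)))
  obtain ⟨r, hr, hball⟩ := Metric.eventually_nhds_iff_ball.1 hev
  set m := ‖x₀‖ + r with hm
  have hm0 : 0 < m := by positivity
  set B := Metric.ball x₀ r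
  -- On the ball `u - v > k / 2`. For such `d` the shift `d² ≤ d ≤ k / 4` leaves `w ≥ k / 4`, and
  -- `d² |x'|² ≤ 1 / 2` leaves `η ≥ 1 / 2`, so `wη ≥ k / 8`.
  refine ⟨(k / 8) ^ (i + 1) * volume.real B, min 1 (min (k / 4) (1 / (2 * m ^ 2))), ?_, ?_, ?_⟩
  · have : 0 < volume.real B :=
      ENNReal.toReal_pos (Metric.measure_ball_pos volume x₀ hr).ne' measure_ball_lt_top.ne
    positivity
  · positivity
  intro d hd hdle
  have hd1 : d ≤ 1 := hdle.trans (min_le_left _ _)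
  have hdk : d ≤ k / 4 := hdle.trans ((min_le_right _ _).trans (min_le_left _ _))
  have hdm : d ≤ 1 / (2 * m ^ 2) := hdle.trans ((min_le_right _ _).trans (min_le_right _ _))
  have hd2 : d ^ 2 ≤ d := pow_le_of_le_one hd.le hd1 two_ne_zero
  have hint : Integrable (truncTest u v S (d ^ 2) d i i) :=
    integrable_truncTest hd (by positivity) hS hsub hb hu hv hu' hv' hi hi
  have hlow : ∀ x ∈ B, (k / 8) ^ (i + 1) ≤ truncTest u v S (d ^ 2) d i i x := by
    intro x hx
    obtain ⟨hxS, hxk⟩ := hball x hx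
    have hw : k / 4 ≤ truncDiff u v S (d ^ 2) x := by
      rw [truncDiff, indicator_of_mem hxS]
      exact le_max_of_le_left (by linarith)
    have hxm : ‖x‖ ≤ m := by
      have h1 := norm_sub_norm_le x x₀
      have h2 : ‖x - x₀‖ < r := by rw [← dist_eq_norm]; exact hx
      linarith
    have hhor : horizSq x ≤ m ^ 2 := by
      have h1 := norm_sq_eq_horizSq_add x
      have h2 : ‖x‖ ^ 2 ≤ m ^ 2 := by gcongr
      nlinarith [sq_nonneg (x (Fin.last n))]
    have hη : 1 / 2 ≤ cutoff d x := by
      refine le_max_of_le_left ?_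
      have h1 : d ^ 2 * horizSq x ≤ 1 / (2 * m ^ 2) * m ^ 2 :=
        mul_le_mul (hd2.trans hdm) hhor (horizSq_nonneg x) (by positivity)
      have h2 : 1 / (2 * m ^ 2) * m ^ 2 = 1 / 2 := by field_simp
      linarith
    rw [← truncDiff_mul_cutoff_pow]
    have : k / 8 ≤ truncDiff u v S (d ^ 2) x * cutoff d x := by
      calc k / 8 = k / 4 * (1 / 2) := by ring
        _ ≤ _ := mul_le_mul hw hη (by norm_num) (truncDiff_nonneg u v S (d ^ 2) x)
    gcongr
  calc (k / 8) ^ (i + 1) * volume.real B = ∫ _ in B, (k / 8) ^ (i + 1) := by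
        rw [setIntegral_const, smul_eq_mul, mul_comm]
    _ ≤ ∫ x in B, truncTest u v S (d ^ 2) d i i x :=
        setIntegral_mono_on (integrableOn_const measure_ball_lt_top.ne) hint.integrableOn
          measurableSet_ball hlow
    _ ≤ _ := setIntegral_le_integral hint
        (Filter.Eventually.of_forall (truncTest_nonneg u v S (d ^ 2) d i i))

end Comparison

/-! ### Absorption and conclusion -/

/-- The comparison principle for gradients bounded by `M` and values in `I`, provided that the
Poincaré constant is small enough. -/
lemma exists_comparison (n : ℕ) (hn : 1 ≤ n) {p q γ M La Lb Lf K lam₀ : ℝ} (hp1 : 1 < p)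
    (hp2 : p < 2) (hq1 : 1 < q) (hγ : 0 < γ) (hM : 0 < M) (hLa : 0 < La) (hLb : 0 < Lb)
    (hLf : 0 < Lf) (hK : 0 < K) (hlam₀ : 0 < lam₀) :
    ∃ τ₀ ε₀ : ℝ, 0 < τ₀ ∧ 0 < ε₀ ∧
      ∀ (a b f : Space n → ℝ → ℝ) (I : Set ℝ) (α : ℝ≥0) (lam y₀ τ ε : ℝ) (u v : Space n → ℝ)
        (S : Set (Space n)), AdmissibleCoeffs γ a b f → CoeffBounds I a b f La Lb Lf K →
        0 < α → 0 < lam → lam ≤ lam₀ → lam / 2 ≤ y₀ → 0 < τ → τ < τ₀ → 0 < ε → ε < ε₀ →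
        IsComparisonProblem p q a b f α lam y₀ τ ε u v S →
        (∀ x ∈ S, ‖∇ u x‖ ≤ M) → (∀ x ∈ S, ‖∇ v x‖ ≤ M) →
        (∀ x ∈ S, u x ∈ I) → (∀ x ∈ S, v x ∈ I) → ∀ x ∈ S, u x ≤ v x := by
  obtain ⟨c, C, hc, hC, hen⟩ := exists_energy_estimate n hn hp1 hp2 hq1 hγ hM hLa hLb hLf hK
  have h2p : 0 < 2 - p := by linarith
  -- The bracket in `θ` must not exceed `κ` in order that `θ C ≤ c / 2`. Half of `κ` is allotted to
  -- the term with `τ`, half to the term with `ε`.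
  set κ : ℝ := c / (2 * C * lam₀ * (n + 1) ^ 2) with hκ
  have hκ0 : 0 < κ := by positivity
  have hM2 : 0 < (2 * M) ^ (2 - p) := by positivity
  refine ⟨κ / 2 / (2 * M) ^ (2 - p), (κ / (2 * lam₀)) ^ (2 - p)⁻¹ / 2, by positivity,
    by positivity, ?_⟩
  intro a b f I α lam y₀ τ ε u v S hadm hI hα hlam hlamle hy hτ hτle hε hεle hP hMu hMv hIu hIv
    x₀ hx₀
  by_contra hlt
  push Not at hlt
  have hΩo := isOpen_strip (n := n) lam y₀
  have hu1 : ∀ x ∈ strip n lam y₀, ContDiffAt ℝ 1 u x := fun x hx =>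
    hP.reg_u.contDiffAt hα hΩo hx
  have hv1 : ∀ x ∈ strip n lam y₀, ContDiffAt ℝ 1 v x := fun x hx =>
    hP.reg_v.contDiffAt hα hΩo hx
  have hu1S : ∀ x ∈ S, ContDiffAt ℝ 1 u x := fun x hx => hu1 x (hP.subset hx)
  have hv1S : ∀ x ∈ S, ContDiffAt ℝ 1 v x := fun x hx => hv1 x (hP.subset hx)
  have huS : ContinuousOn u (closure S) := hP.reg_u.1.mono (closure_mono hP.subset)
  have hvS : ContinuousOn v (closure S) := hP.reg_v.1.mono (closure_mono hP.subset)
  set θ : ℝ := lam * (n + 1) ^ 2 * (τ * (2 * M) ^ (2 - p) + lam * (2 * ε) ^ (2 - p)) with hθ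
  have hθ0 : 0 ≤ θ := by positivity
  have hθC : θ * C ≤ c / 2 := by
    have h1 : τ * (2 * M) ^ (2 - p) ≤ κ / 2 := ((lt_div_iff₀ hM2).1 hτle).le
    have h2 : (2 * ε) ^ (2 - p) ≤ κ / (2 * lam₀) := by
      have : 2 * ε ≤ (κ / (2 * lam₀)) ^ (2 - p)⁻¹ := by linarith
      calc (2 * ε) ^ (2 - p) ≤ ((κ / (2 * lam₀)) ^ (2 - p)⁻¹) ^ (2 - p) := by gcongr
        _ = _ := Real.rpow_inv_rpow (by positivity) h2p.ne'
    calc θ * C ≤ lam₀ * (n + 1) ^ 2 * (κ / 2 + lam₀ * (κ / (2 * lam₀))) * C := by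
          rw [hθ]; gcongr
      _ = c / 2 := by rw [hκ]; field_simp; ring
  obtain ⟨c₀, d₀, hc₀, hd₀, hlow⟩ := exists_lower_bound_integral (i := 2 * n + 1) hP.isOpen
    hP.subset hP.boundary huS hvS hu1S hv1S hx₀ hlt (by omega)
  -- Here `d` may depend on the solutions, since `τ₀` and `ε₀` are already fixed. The last bound
  -- makes the error at most `c₀ / 2`.
  set d : ℝ := min (min 1 d₀) (c₀ / (2 * (2 ^ n * lam))) with hd_def
  have hd : 0 < d := by positivity
  have hd1 : d ≤ 1 := (min_le_left _ _).trans (min_le_left _ _)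
  have hdd₀ : d ≤ d₀ := (min_le_left _ _).trans (min_le_right _ _)
  have hδ : 0 < d ^ 2 := by positivity
  have hlow' := hlow d hd hdd₀
  have hen' := hen a b f I u v S lam y₀ d hadm hI hy hlam hd hd1 hP.isOpen hP.subset hP.boundary
    hP.reg_u.1 hP.reg_v.1 hu1 hv1 (hP.reg_u.continuousOn_gradient hα hΩo)
    (hP.reg_v.continuousOn_gradient hα hΩo) hMu hMv hIu hIv hP.sub_u hP.super_v
  have hpoin := lintegral_truncDiff_pow_le hn hp2 hM.le hτ.le hε.le hlam.le hd hδ hP.isOpen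
    hP.subset hP.boundary huS hvS hu1S hv1S hP.split hMu hMv
  rw [← hθ] at hpoin
  have i_E : Integrable (energyDensity p u v S (d ^ 2) d) :=
    integrable_energyDensity hn hp1 hd hδ hP.isOpen hP.subset hP.boundary huS hvS hu1S hv1S hMu hMv
  have i_T : Integrable (truncTest u v S (d ^ 2) d (2 * n + 1) (2 * n + 1)) :=
    integrable_truncTest hd hδ hP.isOpen hP.subset hP.boundary huS hvS hu1S hv1S (by omega)
      (by omega)
  set J := ∫ x, truncTest u v S (d ^ 2) d (2 * n + 1) (2 * n + 1) x
  set E := ∫ x, energyDensity p u v S (d ^ 2) d x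
  have hE0 : 0 ≤ E := integral_nonneg (energyDensity_nonneg p u v S (d ^ 2) d)
  have hJE : J ≤ θ * E := by
    simp only [truncDiff_mul_cutoff_pow] at hpoin
    rw [← ofReal_integral_eq_lintegral_ofReal i_T
      (Filter.Eventually.of_forall (truncTest_nonneg _ _ _ _ _ _ _)),
      ← ofReal_integral_eq_lintegral_ofReal i_E
      (Filter.Eventually.of_forall (energyDensity_nonneg _ _ _ _ _ _)),
      ← ENNReal.ofReal_mul hθ0] at hpoin
    exact (ENNReal.ofReal_le_ofReal_iff (by positivity)).1 hpoin
  set e := d ^ (2 * n + 2) * ((2 / d) ^ n * lam) with he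
  have hJe : J ≤ e := by
    have h1 : c * J ≤ c / 2 * (J + e) := by
      have hJe0 : 0 ≤ J + e := by
        have : 0 ≤ e := by positivity
        linarith
      -- Poincaré, then the energy estimate, then smallness of `θ`: half of `J` is absorbed.
      calc c * J ≤ c * (θ * E) := by gcongr
        _ = θ * (c * E) := by ring
        _ ≤ θ * (C * (J + e)) := by gcongr
        _ = θ * C * (J + e) := by ring
        _ ≤ _ := by gcongr
    have h2 : c / 2 * J ≤ c / 2 * e := by linarith
    exact le_of_mul_le_mul_left h2 (by positivity)
  have hesmall : e ≤ 2 ^ n * lam * d := by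
    have h1 : e = 2 ^ n * lam * d ^ (n + 2) := by
      rw [he, div_pow, show 2 * n + 2 = n + 2 + n by ring, pow_add d (n + 2) n]; field_simp
    rw [h1]
    gcongr
    exact pow_le_of_le_one hd.le hd1 (by omega)
  have hdc : d ≤ c₀ / (2 * (2 ^ n * lam)) := min_le_right _ _
  rw [le_div_iff₀ (by positivity)] at hdc
  linarith

end StripComparison

end

theorem theorem1p5 (n : ℕ) (hn : 2 ≤ n + 1) (p q : ℝ) (hp1 : 1 < p) (hp2 : p < 2)
    (hq1 : 1 < q) (hqp : q ≤ p)
    (lam₀ M₀ γ : ℝ) (hlam₀ : 0 < lam₀) (hM₀ : 0 < M₀) (hγ : 0 < γ)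
    (La Lb Lf K : ℝ) (hLa : 0 < La) (hLb : 0 < Lb) (hLf : 0 < Lf) (hK : 0 < K) :
    ∃ τ₀ ε₀ : ℝ, 0 < τ₀ ∧ 0 < ε₀ ∧
      ∀ a b f : StripComparison.Space n → ℝ → ℝ,
        StripComparison.AdmissibleCoeffs γ a b f →
        ∀ (α : ℝ≥0) (lam y₀ τ ε : ℝ) (u v : StripComparison.Space n → ℝ)
          (S : Set (StripComparison.Space n)),
          0 < α → α < 1 → 0 < lam → lam ≤ lam₀ → lam / 2 ≤ y₀ →
          0 < τ → τ < τ₀ → 0 < ε → ε < ε₀ →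
          StripComparison.IsComparisonProblem p q a b f α lam y₀ τ ε u v S →
          -- locally Lipschitz coefficients, with structural constants `La, Lb, Lf, K` at level `M₀`
          (StripComparison.LocallyLipschitzCoeffs a b f →
            StripComparison.CoeffBounds (Icc (-M₀) M₀) a b f La Lb Lf K →
            StripComparison.supNorm (StripComparison.strip n lam y₀) u
              + StripComparison.supNorm (StripComparison.strip n lam y₀) (fun x => ∇ u x)
                ≤ ENNReal.ofReal M₀ →
            StripComparison.supNorm (StripComparison.strip n lam y₀) v
              + StripComparison.supNorm (StripComparison.strip n lam y₀) (fun x => ∇ v x)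
                ≤ ENNReal.ofReal M₀ →
            ∀ x ∈ S, u x ≤ v x) ∧
          -- globally Lipschitz `a, b, f` and bounded `a, b`: only the gradients are bounded
          (StripComparison.CoeffBounds univ a b f La Lb Lf K →
            StripComparison.supNorm (StripComparison.strip n lam y₀) (fun x => ∇ u x)
                ≤ ENNReal.ofReal M₀ →
            StripComparison.supNorm (StripComparison.strip n lam y₀) (fun x => ∇ v x)
                ≤ ENNReal.ofReal M₀ →
            ∀ x ∈ S, u x ≤ v x) := by
  obtain ⟨τ₀, ε₀, hτ₀, hε₀, h⟩ := StripComparison.exists_comparison n (by omega) hp1 hp2 hq1 hγ hM₀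
    hLa hLb hLf hK hlam₀
  refine ⟨τ₀, ε₀, hτ₀, hε₀, ?_⟩
  intro a b f hadm α lam y₀ τ ε u v S hα _ hlam hlamle hy hτ hττ hε hεε hP
  have hΩ := StripComparison.isOpen_strip (n := n) lam y₀
  have hgu := hP.reg_u.continuousOn_gradient hα hΩ
  have hgv := hP.reg_v.continuousOn_gradient hα hΩ
  -- The two cases differ only in the range `I` of `u` and `v`: `[-M₀, M₀]` or the whole line. The
  -- constants are common to both.
  refine ⟨fun _ hI hu hv => ?_, fun hI hu hv => ?_⟩
  · have hu1 := StripComparison.norm_le_of_supNorm_le hΩ (hP.reg_u.1.mono subset_closure) hM₀.le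
      (le_self_add.trans hu)
    have hv1 := StripComparison.norm_le_of_supNorm_le hΩ (hP.reg_v.1.mono subset_closure) hM₀.le
      (le_self_add.trans hv)
    have hu2 := StripComparison.norm_le_of_supNorm_le hΩ hgu hM₀.le (le_add_self.trans hu)
    have hv2 := StripComparison.norm_le_of_supNorm_le hΩ hgv hM₀.le (le_add_self.trans hv)
    exact h a b f _ α lam y₀ τ ε u v S hadm hI hα hlam hlamle hy hτ hττ hε hεε hP
      (fun x hx => hu2 x (hP.subset hx)) (fun x hx => hv2 x (hP.subset hx))
      (fun x hx => abs_le.1 (hu1 x (hP.subset hx))) (fun x hx => abs_le.1 (hv1 x (hP.subset hx)))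
  · have hu2 := StripComparison.norm_le_of_supNorm_le hΩ hgu hM₀.le hu
    have hv2 := StripComparison.norm_le_of_supNorm_le hΩ hgv hM₀.le hv
    exact h a b f _ α lam y₀ τ ε u v S hadm hI hα hlam hlamle hy hτ hττ hε hεε hP
      (fun x hx => hu2 x (hP.subset hx)) (fun x hx => hv2 x (hP.subset hx))
      (fun _ _ => mem_univ _) (fun _ _ => mem_univ _)
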